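/- Fix real numbers $s>0$ and $\beta>0$. For a positive integer $N$ let $G_{s,\beta}(N)$ be the following random graph with vertex set the cycle $\mathbb{Z}/N\mathbb{Z}$. Put $\rho(x,y)=\min(|x-y|,\,N-|x-y|)$, where $x,y$ are represented in $\{0,\dots,N-1\}$. Two vertices $x,y$ with $\rho(x,y)=1$ are always joined by an edge; any other two distinct vertices $x,y$ are joined with probability $1-\exp(-\beta\rho(x,y)^{-s})$; all these edges are independent of each other. Let $D(N)$ be the diameter of $G_{s,\beta}(N)$ in the graph metric. Then the following hold, where all constants may depend on $s$ and $\beta$ only. (A) If $s>2$, then there is a constant $C>0$ such that $\lim_{N\to\infty}\mathbf{P}(D(N)<CN)=0$. Moreover, there is a constant $\eta$ with $0<\eta\le 1$ such that $D(N)/N\to\eta$ in distribution as $N\to\infty$. (B) If $s<1$, then there is a constant $C$ such that $\lim_{N\to\infty}\mathbf{P}(D(N)>C)=0$. (C) If $1<s<2$, then there is a constant $\delta$ such that $\lim_{N\to\infty}\mathbf{P}(D(N)>(\log N)^{\delta})=0$. (D) If $1<s<2$, then there is a constant $C>0$ such that $\lim_{N\to\infty}\mathbf{P}(D(N)<C\log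 N)=0$. -/

import Mathlib

open MeasureTheory ProbabilityTheory Filter Topology

namespace LongRange

/-- The distance `ρ(x, y)` on the cycle `ℤ/Nℤ`, the absolute value of the representative of `x - y`
of least absolute value; see `cycleDist_eq_min` for the formula in terms of representatives. -/
def cycleDist {N : ℕ} (x y : ZMod N) : ℕ := (x - y).valMinAbs.natAbs

theorem cycleDist_comm {N : ℕ} (x y : ZMod N) : cycleDist x y = cycleDist y x := by
  unfold cycleDist
  rw [← neg_sub, ZMod.natAbs_valMinAbs_neg]

/-- `ρ(x, y) = min (|x - y|, N - |x - y|)`, with `x` and `y` represented in `{0, …, N - 1}`. -/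
theorem cycleDist_eq_min {N : ℕ} [NeZero N] (x y : ZMod N) :
    (cycleDist x y : ℤ) =
      min |(x.val : ℤ) - (y.val : ℤ)| ((N : ℤ) - |(x.val : ℤ) - (y.val : ℤ)|) := by
  wlog h : y.val ≤ x.val generalizing x y
  · rw [cycleDist_comm, this y x (by omega), abs_sub_comm]
  · have hx := x.val_lt
    rw [cycleDist, ZMod.valMinAbs_natAbs_eq_min, ZMod.val_sub h, abs_of_nonneg (by omega)]
    omega

/-- The number `1 - exp (-β ρ^{-s})`, as a point of `[0, 1]`. For `β ≥ 0` it lies in `[0, 1]` and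
the projection to `[0, 1]` does nothing. -/
noncomputable def bondProb (s β : ℝ) (ρ : ℕ) : unitInterval :=
  Set.projIcc 0 1 zero_le_one (1 - Real.exp (-β * (ρ : ℝ) ^ (-s)))

/-- The probability that the unordered pair `e` is open. -/
noncomputable def pairProb (s β : ℝ) {N : ℕ} (e : Sym2 (ZMod N)) : unitInterval :=
  Sym2.lift ⟨fun x y => bondProb s β (cycleDist x y),
    fun x y => by simp only [cycleDist_comm x y]⟩ e

/-- A configuration declares every unordered pair of vertices open (`true`) or closed (`false`). -/
abbrev Config (N : ℕ) : Type := Sym2 (ZMod N) → Bool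

/-- The law of the configuration: the pairs are independent, and the pair `{x, y}` is open with
probability `1 - exp (-β ρ(x, y)^{-s})`. -/
noncomputable def law (s β : ℝ) (N : ℕ) [NeZero N] : Measure (Config N) :=
  Measure.pi fun e : Sym2 (ZMod N) => bernoulliMeasure true false (pairProb s β e)

instance (s β : ℝ) (N : ℕ) [NeZero N] : IsProbabilityMeasure (law s β N) := by
  unfold law
  infer_instance

/-- The graph `G_{s,β}(N)` as a function of the configuration, which has the law `law s β N`:
vertices at distance `1` are always joined, and any other two distinct vertices are joined when
their pair is open. -/
def graph {N : ℕ} (ω : Config N) : SimpleGraph (ZMod N) where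
  Adj x y := x ≠ y ∧ (cycleDist x y = 1 ∨ ω s(x, y) = true)
  symm := ⟨fun x y h => ⟨h.1.symm, by rw [cycleDist_comm, Sym2.eq_swap]; exact h.2⟩⟩
  loopless := ⟨fun _ h => h.1 rfl⟩

/-- The graph is connected, so that its natural-number valued diameter is the true one. -/
theorem graph_connected {N : ℕ} [NeZero N] (ω : Config N) : (graph ω).Connected := by
  have key : ∀ k : ℕ, (graph ω).Reachable 0 (k : ZMod N) := by
    intro k
    induction k with
    | zero => simp
    | succ k ih =>
      by_cases hN : ((k + 1 : ℕ) : ZMod N) = (k : ZMod N)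
      · rw [hN]; exact ih
      · refine ih.trans (SimpleGraph.Adj.reachable ⟨fun h => hN h.symm, Or.inl ?_⟩)
        have h2 : 2 ≤ N := by
          by_contra h
          have : N = 1 := by have := NeZero.ne N; omega
          subst this
          exact hN (Subsingleton.elim _ _)
        rw [cycleDist_comm, cycleDist]
        have h3 : (((k + 1 : ℕ) : ZMod N) - (k : ZMod N)) = ((1 : ℕ) : ZMod N) := by
          push_cast; ring
        rw [h3, ZMod.valMinAbs_natCast_of_le_half (by omega)]
        rfl
  refine ⟨fun x y => ?_⟩
  have hx := key x.val
  have hy := key y.val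
  rw [ZMod.natCast_zmod_val] at hx hy
  exact hx.symm.trans hy

/-- The diameter `D(N)` of the graph, in the graph metric. -/
noncomputable def diameter {N : ℕ} (ω : Config N) : ℕ := (graph ω).diam

end LongRange

/-!
The cycle steps are always present, so the graph is connected and its distance is at most `ρ`. All
four parts come from first moment bounds and independence of disjoint sets of pairs; a general
tool is that the law is a product of Bernoulli measures (`bitLaw`).

* For `s < 1` all edge probabilities are at least of order `N^{-s}`. A union bound
  (`prob_not_expands_le`) shows that with large probability every set `A` has at least
  `N^{(1-s)/2} |A|` vertices in its closed neighbourhood, or more than `N / 2` of them. A bounded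
  number of steps then exhausts half of the cycle from every vertex, so any two balls of bounded
  radius meet.
* For `s < 2` choose `γ` with `s / 2 < γ < 1`. The two end segments of length `d^γ` of an arc of
  length `d` fail to be joined with probability at most `exp (-β d^{2γ-s})`, which stays small
  when summed over all arcs with `d` above a power of `log N` (`prob_not_bridged_le`). Using these
  bridges recursively, the distance `F(d)` between the ends of an arc satisfies
  `F(d) ≤ 2 F(d^γ) + 1`, and is polylogarithmic (`Bridged.dist_le`).
* For `s > 1` the expected degrees are bounded by a constant `M`, so that a ball of radius `r` has
  at most `(1 + M)^r` vertices on average (`integral_card_avoidBall_le`), too few to fill the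
  cycle when `r` is a small multiple of `log N`.
* For `s > 2` cut the cycle into blocks of a fixed length `n`. The distances between the ends of
  the blocks, measured inside the blocks, are independent and identically distributed with mean
  `τ - 1`, and their sum along the cycle is close to `τ N / n` (`integral_abs_blockSum_sub_le`). Up
  to a bounded error, half of this circuit length is an upper bound for the diameter
  (`two_mul_diameter_le`), and after subtracting the total length of the open pairs that are not
  inside a block it is a lower bound (`circuitLen_le`). Since `∑ l^{1-s}` converges, that total
  length is in the mean at most `ε(n) N` with `ε(n) → 0` (`integral_crossLen_le`). So the mean of
  `D(N) / N` is a Cauchy sequence, and `D(N) / N` converges in mean to its limit `η`. The limit is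
  positive because a block has a positive density of points that no open pair crosses
  (`sum_cutAt_le_blockLen`, `prob_cutAt_ge`).
-/

namespace LongRange

/-! ### Independent Bernoulli families -/

/-- The law of a family of independent bits, the bit `e` being `true` with probability `p e`. -/
noncomputable def bitLaw {ι : Type*} [Fintype ι] (p : ι → unitInterval) : Measure (ι → Bool) :=
  Measure.pi fun e => bernoulliMeasure true false (p e)

instance {ι : Type*} [Fintype ι] (p : ι → unitInterval) : IsProbabilityMeasure (bitLaw p) := by
  unfold bitLaw
  infer_instance

theorem eq_comp_restrict {ι α : Type*} [DecidableEq ι] {C : Finset ι} {u : (ι → Bool) → α}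
    (hu : DependsOn u (C : Set ι)) :
    u = (fun v : C → Bool => u fun e => if he : e ∈ C then v ⟨e, he⟩ else false) ∘
      fun ω (i : C) => ω i := by
  funext ω
  refine hu fun e he => ?_
  simp [Finset.mem_coe.1 he]

section Bits

variable {ι : Type*} [Fintype ι] (p : ι → unitInterval)

theorem bitLaw_forall_closed (F : Finset ι) :
    (bitLaw p).real {ω | ∀ e ∈ F, ω e = false} = ∏ e ∈ F, (1 - (p e : ℝ)) := by
  classical
  have h : {ω : ι → Bool | ∀ e ∈ F, ω e = false} =
      Set.univ.pi fun e => if e ∈ F then {false} else Set.univ := by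
    ext ω
    simp only [Set.mem_ofPred_eq, Set.mem_pi, Set.mem_univ, true_implies]
    refine forall_congr' fun e => ?_
    by_cases he : e ∈ F <;> simp [he]
  rw [h, measureReal_def, bitLaw, Measure.pi_pi, ENNReal.toReal_prod,
    ← Finset.prod_subset (Finset.subset_univ F)]
  · refine Finset.prod_congr rfl fun e he => ?_
    rw [if_pos he, ← measureReal_def,
      bernoulliMeasure_real_apply_of_notMem_of_mem _ (by simp) (by simp) (by simp)]
  · intro e _ he
    simp [he]

theorem bitLaw_open (e : ι) : (bitLaw p).real {ω | ω e = true} = p e := by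
  have h := probReal_compl_eq_one_sub (μ := bitLaw p) (s := {ω | ω e = true})
    (Set.toFinite _).measurableSet
  have h2 : {ω : ι → Bool | ω e = true}ᶜ = {ω | ∀ e' ∈ ({e} : Finset ι), ω e' = false} := by
    ext ω; simp
  rw [h2, bitLaw_forall_closed] at h
  simp at h
  linarith

theorem iIndepFun_bitLaw : iIndepFun (fun (e : ι) (ω : ι → Bool) => ω e) (bitLaw p) :=
  iIndepFun_pi (X := fun _ => id) fun _ => aemeasurable_id

/-- Functions of disjoint sets of bits are independent. -/
theorem indepFun_of_dependsOn {α γ : Type*} [MeasurableSpace α] [MeasurableSpace γ]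
    {f : (ι → Bool) → α} {g : (ι → Bool) → γ} {A B : Finset ι} (hAB : Disjoint A B)
    (hf : DependsOn f (A : Set ι)) (hg : DependsOn g (B : Set ι)) :
    IndepFun f g (bitLaw p) := by
  classical
  have h := (iIndepFun_bitLaw p).indepFun_finset A B hAB fun e => measurable_pi_apply e
  rw [eq_comp_restrict hf, eq_comp_restrict hg]
  exact h.comp (.of_discrete) (.of_discrete)

theorem map_bitLaw_comp {κ : Type*} [Fintype κ] {j : κ → ι} (hj : Function.Injective j) :
    (bitLaw p).map (fun ω e => ω (j e)) = bitLaw (p ∘ j) := by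
  have h := ((iIndepFun_bitLaw p).precomp hj).map_fun_eq_pi_map fun e =>
    (measurable_pi_apply (j e)).aemeasurable
  rw [h]
  unfold bitLaw
  congr 1
  funext e
  exact (measurePreserving_eval (fun e => bernoulliMeasure true false (p e)) (j e)).map_eq

theorem integral_indicator_open (e : ι) :
    ∫ ω, (if ω e = true then (1 : ℝ) else 0) ∂bitLaw p = p e := by
  have h : (fun ω : ι → Bool => if ω e = true then (1 : ℝ) else 0) =
      Set.indicator {ω | ω e = true} 1 := by
    funext ω; simp [Set.indicator_apply]
  rw [h, integral_indicator_one (Set.toFinite _).measurableSet, bitLaw_open]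

end Bits

/-- If the bits in `F` are `false` with probabilities at most `exp (-c)`, then all of them are
`false` with probability at most `exp (-c |F|)`. -/
theorem bitLaw_forall_closed_le {ι : Type*} [Fintype ι] {p : ι → unitInterval} {F : Finset ι}
    {c : ℝ} (h : ∀ e ∈ F, 1 - (p e : ℝ) ≤ Real.exp (-c)) :
    (bitLaw p).real {ω | ∀ e ∈ F, ω e = false} ≤ Real.exp (-c * F.card) := by
  rw [bitLaw_forall_closed]
  calc _ ≤ ∏ _e ∈ F, Real.exp (-c) :=
        Finset.prod_le_prod (fun e _ => sub_nonneg.2 (p e).2.2) h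
    _ = _ := by rw [Finset.prod_const, ← Real.exp_nat_mul, mul_comm]

/-! ### The bond probabilities -/

theorem bondProb_eq {s β : ℝ} (hβ : 0 ≤ β) (ρ : ℕ) :
    (bondProb s β ρ : ℝ) = 1 - Real.exp (-β * (ρ : ℝ) ^ (-s)) := by
  unfold bondProb
  rw [Set.projIcc_of_mem]
  have : 0 ≤ (ρ : ℝ) ^ (-s) := by positivity
  refine ⟨?_, ?_⟩
  · rw [sub_nonneg, Real.exp_le_one_iff]
    nlinarith
  · have := Real.exp_pos (-β * (ρ : ℝ) ^ (-s))
    linarith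

theorem one_sub_bondProb {s β : ℝ} (hβ : 0 ≤ β) (ρ : ℕ) :
    1 - (bondProb s β ρ : ℝ) = Real.exp (-β * (ρ : ℝ) ^ (-s)) := by
  rw [bondProb_eq hβ]; ring

theorem bondProb_le {s β : ℝ} (hβ : 0 ≤ β) (ρ : ℕ) :
    (bondProb s β ρ : ℝ) ≤ β * (ρ : ℝ) ^ (-s) := by
  rw [bondProb_eq hβ]
  have := Real.add_one_le_exp (-β * (ρ : ℝ) ^ (-s))
  linarith

theorem one_sub_bondProb_le {s β : ℝ} (hs : 0 ≤ s) (hβ : 0 ≤ β) {ρ L : ℕ} (hρ : 0 < ρ)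
    (h : ρ ≤ L) : 1 - (bondProb s β ρ : ℝ) ≤ Real.exp (-(β * (L : ℝ) ^ (-s))) := by
  rw [one_sub_bondProb hβ, Real.exp_le_exp, neg_mul, neg_le_neg_iff]
  refine mul_le_mul_of_nonneg_left ?_ hβ
  exact Real.rpow_le_rpow_of_nonpos (by positivity) (by exact_mod_cast h) (by linarith)

theorem law_eq_bitLaw (s β : ℝ) (N : ℕ) [NeZero N] : law s β N = bitLaw (pairProb s β) := rfl

@[simp] theorem pairProb_mk (s β : ℝ) {N : ℕ} (x y : ZMod N) :
    pairProb s β s(x, y) = bondProb s β (cycleDist x y) := rfl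

/-! ### Geometry of the cycle -/

theorem cycleDist_pos {N : ℕ} {x y : ZMod N} (h : x ≠ y) : 0 < cycleDist x y := by
  unfold cycleDist
  rw [Int.natAbs_pos, Ne, ZMod.valMinAbs_eq_zero]
  exact sub_ne_zero.2 h

theorem cycleDist_le {N : ℕ} [NeZero N] (x y : ZMod N) : cycleDist x y ≤ N / 2 :=
  ZMod.natAbs_valMinAbs_le _

theorem cycleDist_add_natCast_le {N : ℕ} (x : ZMod N) (d : ℕ) : cycleDist x (x + d) ≤ d := by
  rw [cycleDist_comm, cycleDist, add_sub_cancel_left]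
  rcases Nat.eq_zero_or_pos N with h | h
  · subst h; exact le_of_eq (Int.natAbs_natCast d)
  have : NeZero N := ⟨h.ne'⟩
  have := ZMod.natAbs_min_of_le_div_two N (d : ZMod N).valMinAbs d (by simp)
    (by simpa using ZMod.natAbs_valMinAbs_le (d : ZMod N))
  simpa using this

/-- A function on the cycle that changes by at most `1` at each step is `1`-Lipschitz for the
distance of the cycle. -/
theorem abs_sub_le_cycleDist {N : ℕ} {G : ZMod N → ℤ} (hG : ∀ x, |G (x + 1) - G x| ≤ 1)
    (x y : ZMod N) : |G x - G y| ≤ cycleDist x y := by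
  have key : ∀ (k : ℕ) (z : ZMod N), |G (z + k) - G z| ≤ k := by
    intro k
    induction k with
    | zero => simp
    | succ k ih =>
      intro z
      have h1 := hG (z + k)
      have h2 := ih z
      push_cast
      rw [← add_assoc]
      rw [abs_le] at *
      constructor <;> linarith
  have hxy : x = y + ((x - y).valMinAbs : ZMod N) := by simp
  unfold cycleDist
  rcases Int.natAbs_eq (x - y).valMinAbs with h | h
  · have := key (x - y).valMinAbs.natAbs y
    have h3 : y + ((x - y).valMinAbs.natAbs : ZMod N) = x := by
      conv_rhs => rw [hxy, h]
      simp
    rwa [h3] at this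
  · have := key (x - y).valMinAbs.natAbs x
    have h3 : x + ((x - y).valMinAbs.natAbs : ZMod N) = y := by
      conv_lhs => enter [1]; rw [hxy, h]
      simp
    rw [h3, abs_sub_comm] at this
    exact this

/-- At most two vertices lie at a given distance from `x`, one in each direction. -/
theorem sum_cycleDist_le {N : ℕ} [NeZero N] {F : ℕ → ℝ} (hF : ∀ l, 0 ≤ F l) (x : ZMod N) :
    ∑ y, F (cycleDist x y) ≤ 2 * ∑ l ∈ Finset.range (N + 1), F l := by
  have h1 : ∑ y, F (cycleDist x y) = ∑ z : ZMod N, F z.valMinAbs.natAbs := by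
    refine Fintype.sum_equiv (Equiv.subLeft x) _ _ fun y => ?_
    simp [cycleDist]
  have h2 : ∑ z : ZMod N, F z.valMinAbs.natAbs ≤ ∑ z : ZMod N, (F z.val + F (N - z.val)) := by
    refine Finset.sum_le_sum fun z _ => ?_
    rw [ZMod.valMinAbs_natAbs_eq_min]
    rcases min_choice z.val (N - z.val) with h | h <;> rw [h]
    · linarith [hF (N - z.val)]
    · linarith [hF z.val]
  have h3 : ∀ H : ℕ → ℝ, ∑ z : ZMod N, H z.val = ∑ l ∈ Finset.range N, H l := by
    intro H
    obtain ⟨n, rfl⟩ := Nat.exists_eq_succ_of_ne_zero (NeZero.ne N)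
    exact Fin.sum_univ_eq_sum_range H (n + 1)
  have h4 : ∑ l ∈ Finset.range N, F (N - l) ≤ ∑ l ∈ Finset.range (N + 1), F l := by
    rw [← Finset.sum_range_reflect F (N + 1), Finset.sum_range_succ]
    simp only [add_tsub_cancel_right]
    linarith [hF (N - N)]
  have h5 : ∑ l ∈ Finset.range N, F l ≤ ∑ l ∈ Finset.range (N + 1), F l := by
    rw [Finset.sum_range_succ]; linarith [hF N]
  rw [h1]
  refine h2.trans ?_
  rw [Finset.sum_add_distrib, h3 F, h3 fun v => F (N - v)]
  linarith

/-! ### Distances and the diameter -/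

theorem dist_le_diameter {N : ℕ} [NeZero N] (ω : Config N) (x y : ZMod N) :
    (graph ω).dist x y ≤ diameter ω :=
  SimpleGraph.dist_le_diam (SimpleGraph.connected_iff_ediam_ne_top.1 (graph_connected ω))

theorem diameter_le {N : ℕ} (ω : Config N) {k : ℕ} (h : ∀ x y, (graph ω).dist x y ≤ k) :
    diameter ω ≤ k := by
  obtain ⟨u, v, huv⟩ := (graph ω).exists_dist_eq_diam
  rw [diameter, ← huv]
  exact h u v

theorem dist_succ_le {N : ℕ} (ω : Config N) (x : ZMod N) : (graph ω).dist (x + 1) x ≤ 1 := by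
  by_cases h : x + 1 = x
  · simp [h]
  · have h1 := cycleDist_add_natCast_le x 1
    rw [cycleDist_comm] at h1
    have h2 := cycleDist_pos h
    push_cast at h1
    have h3 : (graph ω).Adj (x + 1) x := ⟨h, Or.inl (by omega)⟩
    exact (SimpleGraph.dist_eq_one_iff_adj.2 h3).le

theorem dist_le_cycleDist {N : ℕ} [NeZero N] (ω : Config N) (x y : ZMod N) :
    (graph ω).dist x y ≤ cycleDist x y := by
  have h := abs_sub_le_cycleDist (G := fun z => ((graph ω).dist z y : ℤ)) (fun z => by
    have h1 := dist_succ_le ω z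
    have h2 := (graph_connected ω).dist_triangle (u := z + 1) (v := z) (w := y)
    have h3 := (graph_connected ω).dist_triangle (u := z) (v := z + 1) (w := y)
    rw [(graph ω).dist_comm (u := z) (v := z + 1)] at h3
    rw [abs_le]
    constructor <;> omega) x y
  simpa using h

theorem diameter_le_card {N : ℕ} [NeZero N] (ω : Config N) : diameter ω ≤ N := by
  refine diameter_le ω fun x y => (dist_le_cycleDist ω x y).trans ?_
  have := cycleDist_le x y
  omega

/-- To prove that the probabilities of the events `E N` tend to `0` it is enough to bound them for
large `N` by real numbers that do. -/
theorem tendsto_law_of_le {s β : ℝ} {E : ∀ N : ℕ+, Set (Config N)} {b : ℕ → ℝ}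
    (hb : Tendsto b atTop (𝓝 0))
    (h : ∀ᶠ N : ℕ in atTop, ∀ M : ℕ+, (M : ℕ) = N → (law s β M).real (E M) ≤ b N) :
    Tendsto (fun N : ℕ+ => law s β N (E N)) atTop (𝓝 0) := by
  have hc : Tendsto (fun N : ℕ+ => (N : ℕ)) atTop atTop :=
    tendsto_PNat_val_atTop_atTop
  have h1 : Tendsto (fun N : ℕ+ => (law s β N).real (E N)) atTop (𝓝 0) := by
    refine squeeze_zero' (Eventually.of_forall fun N => measureReal_nonneg) ?_ (hb.comp hc)
    filter_upwards [hc.eventually h] with N hN using hN N rfl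
  have h2 := (ENNReal.continuous_ofReal.tendsto 0).comp h1
  simpa [Function.comp_def, ofReal_measureReal] using h2

/-! ### Logarithmic lower bound: growth of balls when `s > 1` -/

open Classical in
/-- The set of vertices reached from `y` by paths with at most `r` edges that visit no vertex twice
and, after their start, no vertex of `U`. -/
noncomputable def avoidBall {N : ℕ} [NeZero N] (ω : Config N) :
    ℕ → Finset (ZMod N) → ZMod N → Finset (ZMod N)
  | 0, _, y => {y}
  | r + 1, U, y => insert y
      ((Finset.univ.filter fun z => z ∉ insert y U ∧ (graph ω).Adj y z).biUnion
        (avoidBall ω r (insert y U)))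

section Ball

variable {N : ℕ} [NeZero N]

theorem mem_avoidBall_of_isPath (ω : Config N) : ∀ (r : ℕ) (U : Finset (ZMod N)) {y x : ZMod N}
    (p : (graph ω).Walk y x), p.IsPath → p.length ≤ r → (∀ v ∈ p.support, v ∉ U) →
    x ∈ avoidBall ω r U y := by
  classical
  intro r
  induction r with
  | zero =>
    intro U y x p _ hl _
    have := SimpleGraph.Walk.eq_of_length_eq_zero (Nat.le_zero.1 hl)
    simp [avoidBall, this]
  | succ r ih =>
    intro U y x p hp hl hU
    cases p with
    | nil => simp [avoidBall]
    | @cons _ z _ h p =>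
      rw [SimpleGraph.Walk.cons_isPath_iff] at hp
      simp only [SimpleGraph.Walk.length_cons, add_le_add_iff_right] at hl
      have hav : ∀ v ∈ p.support, v ∉ insert y U := by
        intro v hv hvU
        rcases Finset.mem_insert.1 hvU with rfl | hvU
        · exact hp.2 hv
        · exact hU v (by simp [hv]) hvU
      simp only [avoidBall, Finset.mem_insert, Finset.mem_biUnion, Finset.mem_filter,
        Finset.mem_univ, true_and]
      exact Or.inr ⟨z, ⟨by simpa using hav z p.start_mem_support, h⟩, ih _ p hp.1 hl hav⟩

/-- The ball avoiding `U` uses no pair with an end in `U`. -/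
theorem dependsOn_avoidBall : ∀ (r : ℕ) (U : Finset (ZMod N)) (y : ZMod N), y ∉ U →
    DependsOn (fun ω : Config N => avoidBall ω r U y) {e | ∀ u ∈ U, u ∉ e} := by
  classical
  intro r
  induction r with
  | zero => intro U y _ ω ω' _; simp [avoidBall]
  | succ r ih =>
    intro U y hy ω ω' h
    have h1 : (Finset.univ.filter fun z => z ∉ insert y U ∧ (graph ω).Adj y z) =
        Finset.univ.filter fun z => z ∉ insert y U ∧ (graph ω').Adj y z := by
      refine Finset.filter_congr fun z _ => and_congr_right fun hz => ?_
      have : ω s(y, z) = ω' s(y, z) := h _ fun u hu hmem => by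
        rcases Sym2.mem_iff.1 hmem with rfl | rfl
        · exact hy hu
        · exact hz (Finset.mem_insert_of_mem hu)
      simp only [graph, this]
    simp only [avoidBall]
    rw [h1]
    congr 1
    refine Finset.biUnion_congr rfl fun z hz => ?_
    exact ih (insert y U) z (Finset.mem_filter.1 hz).2.1 fun e he =>
      h e fun u hu => he u (Finset.mem_insert_of_mem hu)

/-- If the expected degrees are at most `M`, the expected size of a ball of radius `r` is at most
`(1 + M) ^ r`: the first edge `yz` of a path is independent of the ball around `z` that avoids
`y`. -/
theorem integral_card_avoidBall_le {s β M : ℝ} (hM0 : 0 ≤ M)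
    (hM : ∀ y : ZMod N, ∑ z, (law s β N).real {ω | (graph ω).Adj y z} ≤ M) :
    ∀ (r : ℕ) (U : Finset (ZMod N)) (y : ZMod N),
      ∫ ω, ((avoidBall ω r U y).card : ℝ) ∂law s β N ≤ (1 + M) ^ r := by
  classical
  intro r
  induction r with
  | zero => intro U y; simp [avoidBall]
  | succ r ih =>
    intro U y
    have hpt : ∀ ω : Config N, ((avoidBall ω (r + 1) U y).card : ℝ) ≤
        1 + ∑ z ∈ Finset.univ.filter (fun z => z ∉ insert y U),
          (if (graph ω).Adj y z then (1 : ℝ) else 0) * (avoidBall ω r (insert y U) z).card := by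
      intro ω
      have h1 : (avoidBall ω (r + 1) U y).card ≤ 1 + ∑ z ∈ Finset.univ.filter
          (fun z => z ∉ insert y U ∧ (graph ω).Adj y z), (avoidBall ω r (insert y U) z).card := by
        rw [avoidBall, add_comm]
        exact (Finset.card_insert_le _ _).trans (Nat.add_le_add_right Finset.card_biUnion_le 1)
      refine (Nat.cast_le.2 h1).trans ?_
      push_cast
      rw [← Finset.filter_filter, Finset.sum_filter]
      simp [ite_mul]
    have hind : ∀ z ∈ Finset.univ.filter (fun z => z ∉ insert y U),
        ∫ ω, (if (graph ω).Adj y z then (1 : ℝ) else 0) *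
            (avoidBall ω r (insert y U) z).card ∂law s β N ≤
          (law s β N).real {ω | (graph ω).Adj y z} * (1 + M) ^ r := by
      intro z hz
      have hz' := (Finset.mem_filter.1 hz).2
      have hI : IndepFun (fun ω : Config N => if (graph ω).Adj y z then (1 : ℝ) else 0)
          (fun ω => ((avoidBall ω r (insert y U) z).card : ℝ)) (law s β N) := by
        rw [law_eq_bitLaw]
        refine indepFun_of_dependsOn _ (A := {s(y, z)})
          (B := Finset.univ.filter fun e => ∀ u ∈ insert y U, u ∉ e) ?_ ?_ ?_
        · simp
        · intro ω ω' h
          have : ω s(y, z) = ω' s(y, z) := h _ (by simp)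
          have h2 : (graph ω).Adj y z = (graph ω').Adj y z := by simp only [graph, this]
          simp only [h2]
        · intro ω ω' h
          have : avoidBall ω r (insert y U) z = avoidBall ω' r (insert y U) z :=
            dependsOn_avoidBall r (insert y U) z hz' fun e he => h e (by simpa using he)
          simp only [this]
      rw [hI.integral_fun_mul_eq_mul_integral (Measurable.of_discrete.aestronglyMeasurable)
        (Measurable.of_discrete.aestronglyMeasurable)]
      have : (fun ω : Config N => if (graph ω).Adj y z then (1 : ℝ) else 0) =
          Set.indicator {ω | (graph ω).Adj y z} 1 := by
        funext ω; simp [Set.indicator_apply]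
      rw [this, integral_indicator_one (Set.toFinite _).measurableSet]
      exact mul_le_mul_of_nonneg_left (ih _ _) measureReal_nonneg
    calc _ ≤ ∫ ω, (1 + ∑ z ∈ Finset.univ.filter (fun z => z ∉ insert y U),
          (if (graph ω).Adj y z then (1 : ℝ) else 0) *
            (avoidBall ω r (insert y U) z).card) ∂law s β N :=
          integral_mono .of_finite .of_finite hpt
      _ = 1 + ∑ z ∈ Finset.univ.filter (fun z => z ∉ insert y U),
          ∫ ω, (if (graph ω).Adj y z then (1 : ℝ) else 0) *
            (avoidBall ω r (insert y U) z).card ∂law s β N := by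
          rw [integral_add .of_finite .of_finite, integral_finsetSum _ fun _ _ => .of_finite]
          simp
      _ ≤ 1 + ∑ z ∈ Finset.univ.filter (fun z => z ∉ insert y U),
          (law s β N).real {ω | (graph ω).Adj y z} * (1 + M) ^ r := by
          gcongr with z hz
          exact hind z hz
      _ ≤ 1 + M * (1 + M) ^ r := by
          rw [← Finset.sum_mul]
          gcongr
          exact (Finset.sum_le_univ_sum_of_nonneg fun _ => measureReal_nonneg).trans (hM y)
      _ ≤ (1 + M) ^ (r + 1) := by
          have : 1 ≤ (1 + M) ^ r := one_le_pow₀ (by linarith)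
          rw [pow_succ]
          linarith

/-- If the diameter is at most `r`, then the ball of radius `r` contains all `N` vertices, so that
Markov's inequality applies. -/
theorem prob_diameter_le {s β M : ℝ} (hM0 : 0 ≤ M)
    (hM : ∀ y : ZMod N, ∑ z, (law s β N).real {ω | (graph ω).Adj y z} ≤ M) (r : ℕ) :
    (law s β N).real {ω | diameter ω ≤ r} ≤ (1 + M) ^ r / N := by
  classical
  have hN : (0 : ℝ) < N := by exact_mod_cast NeZero.pos N
  have hsub : {ω : Config N | diameter ω ≤ r} ⊆
      {ω | (N : ℝ) ≤ ((avoidBall ω r ∅ 0).card : ℝ)} := by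
    intro ω hω
    have : avoidBall ω r ∅ 0 = Finset.univ := by
      refine Finset.eq_univ_of_forall fun x => ?_
      obtain ⟨p, hp, hl⟩ := (graph_connected ω).exists_path_of_dist 0 x
      refine mem_avoidBall_of_isPath ω r ∅ p hp ?_ (by simp)
      rw [hl]
      exact (dist_le_diameter ω 0 x).trans hω
    simp [this, ZMod.card]
  rw [le_div_iff₀ hN, mul_comm]
  calc _ ≤ N * (law s β N).real {ω | (N : ℝ) ≤ ((avoidBall ω r ∅ 0).card : ℝ)} := by
        exact mul_le_mul_of_nonneg_left (measureReal_mono hsub) hN.le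
    _ ≤ ∫ ω, ((avoidBall ω r ∅ 0).card : ℝ) ∂law s β N :=
        mul_meas_ge_le_integral_of_nonneg (Eventually.of_forall fun _ => by simp) .of_finite _
    _ ≤ _ := integral_card_avoidBall_le hM0 hM r ∅ 0

end Ball

/-- For `s > 1` the expected degree is bounded uniformly in `N`. -/
theorem sum_prob_adj_le {s β : ℝ} (hs : 1 < s) (hβ : 0 ≤ β) {N : ℕ} [NeZero N] (y : ZMod N) :
    ∑ z, (law s β N).real {ω | (graph ω).Adj y z} ≤ 2 * (1 + β * ∑' l : ℕ, (l : ℝ) ^ (-s)) := by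
  have hsum : Summable fun l : ℕ => (l : ℝ) ^ (-s) := Real.summable_nat_rpow.2 (by linarith)
  set F : ℕ → ℝ := fun l => (if l = 1 then 1 else 0) + β * (l : ℝ) ^ (-s) with hF
  have hF0 : ∀ l, 0 ≤ F l := fun l => by simp only [hF]; split_ifs <;> positivity
  have h1 : ∀ z, (law s β N).real {ω | (graph ω).Adj y z} ≤ F (cycleDist y z) := by
    intro z
    by_cases h : cycleDist y z = 1
    · refine measureReal_le_one.trans ?_
      simp only [hF, h, if_true]
      have : 0 ≤ β * ((1 : ℕ) : ℝ) ^ (-s) := by positivity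
      linarith
    · simp only [hF, h, if_false, zero_add]
      calc _ ≤ (law s β N).real {ω | ω s(y, z) = true} := by
            refine measureReal_mono fun ω hω => ?_
            exact hω.2.resolve_left h
        _ = bondProb s β (cycleDist y z) := by rw [law_eq_bitLaw, bitLaw_open, pairProb_mk]
        _ ≤ _ := bondProb_le hβ _
  calc _ ≤ ∑ z, F (cycleDist y z) := Finset.sum_le_sum fun z _ => h1 z
    _ ≤ 2 * ∑ l ∈ Finset.range (N + 1), F l := sum_cycleDist_le hF0 y
    _ ≤ _ := by
      simp only [hF]
      rw [Finset.sum_add_distrib, ← Finset.mul_sum]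
      gcongr
      · rw [Finset.sum_ite_eq']
        split_ifs <;> simp
      · exact hsum.sum_le_tsum _ fun l _ => by positivity

theorem tendsto_prob_diameter_lt_log {s β : ℝ} (hs : 1 < s) (hβ : 0 < β) :
    ∃ C : ℝ, 0 < C ∧ Tendsto (fun N : ℕ+ => law s β N
      {ω | (diameter ω : ℝ) < C * Real.log (N : ℝ)}) atTop (𝓝 0) := by
  set M : ℝ := 2 * (1 + β * ∑' l : ℕ, (l : ℝ) ^ (-s)) with hM
  have hMpos : 0 < M := by
    have : 0 ≤ ∑' l : ℕ, (l : ℝ) ^ (-s) := tsum_nonneg fun l => by positivity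
    positivity
  have hlog : 0 < Real.log (1 + M) := Real.log_pos (by linarith)
  -- With this constant `(1 + M) ^ (C log N) = √N`.
  refine ⟨1 / (2 * Real.log (1 + M)), by positivity, ?_⟩
  refine tendsto_law_of_le (b := fun N => (N : ℝ) ^ (-(1 / 2 : ℝ)))
    ((tendsto_rpow_neg_atTop (by norm_num)).comp tendsto_natCast_atTop_atTop) ?_
  refine Eventually.of_forall fun N M' hN => ?_
  subst hN
  have hNpos : (0 : ℝ) < (M' : ℕ) := by exact_mod_cast M'.pos
  have hlogN : 0 ≤ Real.log (M' : ℕ) := Real.log_natCast_nonneg _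
  set x : ℝ := 1 / (2 * Real.log (1 + M)) * Real.log (M' : ℕ) with hx
  have hx0 : 0 ≤ x := by positivity
  calc _ ≤ (law s β M').real {ω | diameter ω ≤ ⌊x⌋₊} := by
        refine measureReal_mono fun ω hω => Nat.le_floor (le_of_lt hω)
    _ ≤ (1 + M) ^ ⌊x⌋₊ / (M' : ℕ) :=
        prob_diameter_le hMpos.le (fun y => sum_prob_adj_le hs hβ.le y) _
    _ ≤ (1 + M) ^ x / (M' : ℕ) := by
        gcongr
        rw [← Real.rpow_natCast]
        exact Real.rpow_le_rpow_of_exponent_le (by linarith) (Nat.floor_le hx0)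
    _ = _ := by
        rw [Real.rpow_def_of_pos (by linarith), Real.rpow_def_of_pos hNpos]
        conv_lhs => enter [2]; rw [← Real.exp_log hNpos]
        rw [← Real.exp_sub, hx]
        congr 1
        field_simp
        ring

/-! ### Bounded diameter when `s < 1` -/

/-- If all pairs between two disjoint sets `A` and `B` have length at most `L`, then they are all
closed with probability at most `exp (-β L^{-s} |A| |B|)`. -/
theorem prob_forall_closed_between_le {s β : ℝ} (hs : 0 ≤ s) (hβ : 0 ≤ β) {N : ℕ} [NeZero N]
    {A B : Finset (ZMod N)} (hAB : Disjoint A B) {L : ℕ}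
    (hL : ∀ a ∈ A, ∀ b ∈ B, cycleDist a b ≤ L) :
    (law s β N).real {ω | ∀ a ∈ A, ∀ b ∈ B, ω s(a, b) = false} ≤
      Real.exp (-(β * (L : ℝ) ^ (-s)) * (A.card * B.card)) := by
  classical
  have hne : ∀ a ∈ A, ∀ b ∈ B, a ≠ b := fun a ha b hb h =>
    Finset.disjoint_left.1 hAB ha (h ▸ hb)
  have hcard : ((A ×ˢ B).image fun x => s(x.1, x.2)).card = A.card * B.card := by
    rw [Finset.card_image_of_injOn, Finset.card_product]
    rintro ⟨a, b⟩ h ⟨a', b'⟩ h' heq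
    simp only [Finset.coe_product, Set.mem_prod, Finset.mem_coe] at h h'
    simp only [Sym2.eq_iff] at heq
    rcases heq with ⟨rfl, rfl⟩ | ⟨rfl, rfl⟩
    · rfl
    · exact absurd rfl (hne _ h.1 _ h'.2)
  have h := bitLaw_forall_closed_le (p := pairProb (N := N) s β)
    (F := (A ×ˢ B).image fun x => s(x.1, x.2)) (c := β * (L : ℝ) ^ (-s)) (by
      intro e he
      obtain ⟨⟨a, b⟩, hab, rfl⟩ := Finset.mem_image.1 he
      obtain ⟨ha, hb⟩ := Finset.mem_product.1 hab
      exact one_sub_bondProb_le hs hβ (cycleDist_pos (hne a ha b hb)) (hL a ha b hb))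
  rw [hcard] at h
  refine le_trans (le_of_eq ?_) (h.trans (le_of_eq (by push_cast; rfl)))
  rw [law_eq_bitLaw]
  congr 1
  ext ω
  simp only [Set.mem_ofPred_eq, Finset.mem_image, Finset.mem_product, Prod.exists]
  constructor
  · rintro h e ⟨a, b, ⟨ha, hb⟩, rfl⟩
    exact h a ha b hb
  · exact fun h a ha b hb => h _ ⟨a, b, ⟨ha, hb⟩, rfl⟩

/-- A set with `n` elements has at most `(n + 1) ^ m` subsets with at most `m` elements. -/
theorem card_filter_card_le {α : Type*} [Fintype α] (m : ℕ) :
    (Finset.univ.filter fun B : Finset α => B.card ≤ m).card ≤ (Fintype.card α + 1) ^ m := by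
  classical
  induction m with
  | zero => simp [Finset.filter_eq']
  | succ m ih =>
    have h : (Finset.univ.filter fun B : Finset α => B.card ≤ m + 1) ⊆
        (Finset.univ.filter fun B : Finset α => B.card ≤ m) ∪
          Finset.powersetCard (m + 1) Finset.univ := by
      intro B hB
      simp only [Finset.mem_filter, Finset.mem_univ, true_and, Finset.mem_union,
        Finset.mem_powersetCard, Finset.subset_univ] at hB ⊢
      omega
    calc _ ≤ _ := Finset.card_le_card h
      _ ≤ _ := Finset.card_union_le _ _
      _ ≤ (Fintype.card α + 1) ^ m + Fintype.card α ^ (m + 1) := by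
          rw [Finset.card_powersetCard, Finset.card_univ]
          exact Nat.add_le_add ih (Nat.choose_le_pow _ _)
      _ ≤ (Fintype.card α + 1) ^ m + Fintype.card α * (Fintype.card α + 1) ^ m := by
          rw [pow_succ, mul_comm (Fintype.card α ^ m)]
          gcongr
          omega
      _ = _ := by ring

/-- The configuration expands by the factor `g`: a set `B` of at most half of the vertices and at
most `g |A|` vertices does not contain all the neighbours of its subset `A`. -/
def Expands {N : ℕ} (g : ℕ) (ω : Config N) : Prop :=
  ∀ A B : Finset (ZMod N), A.Nonempty → A ⊆ B → 2 * B.card ≤ N → B.card ≤ g * A.card →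
    ∃ a ∈ A, ∃ b, b ∉ B ∧ ω s(a, b) = true

/-- Balls grow by the factor `g` until they contain more than half of the vertices, after which any
two of them meet. -/
theorem Expands.diameter_le {N : ℕ} [NeZero N] {g m : ℕ} {ω : Config N} (h : Expands g ω)
    (hg : N ≤ g ^ m) : diameter ω ≤ 2 * m := by
  classical
  let ball : ZMod N → ℕ → Finset (ZMod N) := fun x k =>
    Finset.univ.filter fun y => (graph ω).dist x y ≤ k
  have hmono : ∀ x k, ball x k ⊆ ball x (k + 1) := fun x k y hy => by
    simp only [ball, Finset.mem_filter, Finset.mem_univ, true_and] at hy ⊢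
    omega
  have hgrow : ∀ x k, N < 2 * (ball x k).card ∨ g ^ k ≤ (ball x k).card := by
    intro x k
    have hpos : ∀ k, (ball x k).Nonempty := fun k => ⟨x, by simp [ball]⟩
    induction k with
    | zero => exact Or.inr (by simpa using (hpos 0).card_pos)
    | succ k ih =>
      by_contra! hcon
      have h1 := Finset.card_le_card (hmono x k)
      have h2 : g ^ k ≤ (ball x k).card := ih.resolve_left (by omega)
      obtain ⟨a, ha, b, hb, hab⟩ := h (ball x k) (ball x (k + 1)) (hpos k) (hmono x k) hcon.1 (by
        have := Nat.mul_le_mul_left g h2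
        rw [← pow_succ'] at this
        omega)
      have hne : a ≠ b := fun hab => hb (hab ▸ hmono x k ha)
      have hadj : (graph ω).Adj a b := ⟨hne, Or.inr hab⟩
      have h3 := (graph_connected ω).dist_triangle (u := x) (v := a) (w := b)
      rw [SimpleGraph.dist_eq_one_iff_adj.2 hadj] at h3
      simp only [ball, Finset.mem_filter, Finset.mem_univ, true_and] at ha hb
      omega
  have hbig : ∀ x, N < 2 * (ball x m).card := fun x => by
    rcases hgrow x m with h | h
    · exact h
    · have := NeZero.pos N
      omega
  refine LongRange.diameter_le ω fun x y => ?_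
  have hint : ¬ Disjoint (ball x m) (ball y m) := by
    intro hd
    have h1 := Finset.card_union_of_disjoint hd
    have h2 := Finset.card_le_univ (ball x m ∪ ball y m)
    rw [ZMod.card] at h2
    have := hbig x
    have := hbig y
    omega
  obtain ⟨z, hzx, hzy⟩ := Finset.not_disjoint_iff.1 hint
  simp only [ball, Finset.mem_filter, Finset.mem_univ, true_and] at hzx hzy
  have h3 := (graph_connected ω).dist_triangle (u := x) (v := z) (w := y)
  rw [(graph ω).dist_comm (u := z)] at h3
  omega

/-- Union bound over the pairs `A ⊆ B`: for given `A` there are at most `(N + 1) ^ (g |A|)` sets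
`B`, and none of the at least `|A| N / 2` pairs between `A` and the complement of `B` is open with
probability at most `exp (-β N^{-s} |A| N / 2)`. The sum over `A` is a binomial sum. -/
theorem prob_not_expands_le {s β : ℝ} (hs : 0 ≤ s) (hβ : 0 ≤ β) {N : ℕ} [NeZero N] (g : ℕ) :
    (law s β N).real {ω | ¬ Expands g ω} ≤
      Real.exp (N * (((N : ℝ) + 1) ^ g * Real.exp (-(β * (N : ℝ) ^ (-s)) * (N / 2)))) - 1 := by
  classical
  set c : ℝ := β * (N : ℝ) ^ (-s) with hc
  have hc0 : 0 ≤ c := by positivity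
  set t : ℝ := ((N : ℝ) + 1) ^ g * Real.exp (-c * (N / 2)) with ht
  have ht0 : 0 ≤ t := by positivity
  let Bs : Finset (ZMod N) → Finset (Finset (ZMod N)) := fun A =>
    (Finset.univ.filter fun B => B.card ≤ g * A.card).filter fun B => A ⊆ B ∧ 2 * B.card ≤ N
  have hsub : {ω : Config N | ¬ Expands g ω} ⊆ ⋃ A ∈ Finset.univ.filter (fun A => A.Nonempty),
      ⋃ B ∈ Bs A, {ω | ∀ a ∈ A, ∀ b ∈ Bᶜ, ω s(a, b) = false} := by
    intro ω hω
    simp only [Set.mem_ofPred_eq, Expands] at hω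
    push Not at hω
    obtain ⟨A, B, h1, h2, h3, h4, h5⟩ := hω
    simp only [Set.mem_iUnion, Bs]
    refine ⟨A, by simpa using h1, B, by simp [h2, h3, h4], fun a ha b hb => ?_⟩
    simpa using h5 a ha b (by simpa using hb)
  have hone : ∀ A, ∀ B ∈ Bs A, (law s β N).real {ω | ∀ a ∈ A, ∀ b ∈ Bᶜ, ω s(a, b) = false} ≤
      Real.exp (-c * (N / 2)) ^ A.card := by
    intro A B hB
    simp only [Bs, Finset.mem_filter, Finset.mem_univ, true_and] at hB
    have h1 := prob_forall_closed_between_le (s := s) (β := β) hs hβ (A := A) (B := Bᶜ) (L := N)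
      (disjoint_compl_right.mono_left hB.2.1)
      fun a _ b _ => (cycleDist_le a b).trans (Nat.div_le_self N 2)
    refine h1.trans ?_
    rw [← Real.exp_nat_mul, Real.exp_le_exp, ← hc]
    have h2 : (N : ℝ) / 2 ≤ (Bᶜ.card : ℝ) := by
      have := Finset.card_add_card_compl B
      rw [ZMod.card] at this
      have h3 : N ≤ 2 * Bᶜ.card := by omega
      have h4 : (N : ℝ) ≤ 2 * Bᶜ.card := by exact_mod_cast h3
      linarith
    have h3 : (A.card : ℝ) * (N / 2) ≤ A.card * Bᶜ.card := by gcongr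
    nlinarith [mul_le_mul_of_nonneg_left h3 hc0]
  calc _ ≤ _ := measureReal_mono hsub (measure_ne_top _ _)
    _ ≤ ∑ A ∈ Finset.univ.filter (fun A : Finset (ZMod N) => A.Nonempty),
        (law s β N).real (⋃ B ∈ Bs A, {ω | ∀ a ∈ A, ∀ b ∈ Bᶜ, ω s(a, b) = false}) :=
        measureReal_biUnion_finset_le _ _
    _ ≤ ∑ A ∈ Finset.univ.filter (fun A : Finset (ZMod N) => A.Nonempty), t ^ A.card := by
        refine Finset.sum_le_sum fun A _ => ?_
        calc _ ≤ _ := measureReal_biUnion_finset_le _ _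
          _ ≤ ∑ B ∈ Bs A, Real.exp (-c * (N / 2)) ^ A.card := Finset.sum_le_sum (hone A)
          _ ≤ (((N : ℝ) + 1) ^ (g * A.card)) * Real.exp (-c * (N / 2)) ^ A.card := by
              rw [Finset.sum_const, nsmul_eq_mul]
              gcongr
              have h1 : (Bs A).card ≤ (N + 1) ^ (g * A.card) := by
                refine (Finset.card_filter_le _ _).trans ?_
                simpa [ZMod.card] using card_filter_card_le (α := ZMod N) (g * A.card)
              exact_mod_cast h1
          _ = _ := by rw [ht, mul_pow, pow_mul]
    _ = (t + 1) ^ N - 1 := by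
        have h1 := Finset.sum_pow_mul_eq_add_pow t 1 (Finset.univ : Finset (ZMod N))
        simp only [one_pow, mul_one, Finset.powerset_univ, Finset.card_univ, ZMod.card] at h1
        rw [← h1, ← Finset.sum_filter_add_sum_filter_not Finset.univ
          (fun A : Finset (ZMod N) => A.Nonempty)]
        simp [Finset.filter_eq']
    _ ≤ _ := by
        gcongr
        rw [Real.exp_nat_mul]
        gcongr
        exact Real.add_one_le_exp t

theorem tendsto_prob_diameter_gt_const {s β : ℝ} (hs0 : 0 < s) (hs : s < 1) (hβ : 0 < β) :
    ∃ C : ℝ, Tendsto (fun N : ℕ+ => law s β N {ω | C < (diameter ω : ℝ)}) atTop (𝓝 0) := by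
  set h : ℝ := (1 - s) / 2 with hh
  have hpos : 0 < h := by linarith
  obtain ⟨m, hm⟩ := exists_nat_ge (1 / h)
  -- The expansion factor is `N ^ h`, so that `m ≥ 1 / h` steps of growth exhaust the cycle.
  refine ⟨(2 * m : ℕ), ?_⟩
  refine tendsto_law_of_le (b := fun N => Real.exp (Real.exp (-(β / 4) * (N : ℝ) ^ (2 * h))) - 1)
    ?_ ?_
  · have h1 : Tendsto (fun N : ℕ => -(β / 4) * (N : ℝ) ^ (2 * h)) atTop atBot :=
      ((tendsto_rpow_atTop (by linarith)).comp tendsto_natCast_atTop_atTop).const_mul_atTop_of_neg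
        (by linarith)
    have h2 := (Real.continuous_exp.tendsto 0).comp (Real.tendsto_exp_atBot.comp h1)
    rw [Real.exp_zero] at h2
    simpa [Function.comp_def] using h2.sub_const 1
  have hlo := ((isLittleO_log_rpow_atTop hpos).bound (c := β / 24) (by positivity))
  filter_upwards [tendsto_natCast_atTop_atTop.eventually hlo, eventually_ge_atTop 2]
    with N hlogN hN2 M hM
  subst hM
  set n : ℝ := ((M : ℕ) : ℝ) with hn
  have hn2 : (2 : ℝ) ≤ n := Nat.cast_le.2 hN2
  have hn0 : 0 < n := by linarith
  set g : ℕ := ⌈n ^ h⌉₊ with hgdef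
  have hnh : 1 ≤ n ^ h := Real.one_le_rpow (by linarith) hpos.le
  have hgm : (M : ℕ) ≤ g ^ m := by
    have h1 : n ≤ (n ^ h) ^ m := by
      rw [← Real.rpow_natCast, ← Real.rpow_mul hn0.le]
      conv_lhs => rw [← Real.rpow_one n]
      refine Real.rpow_le_rpow_of_exponent_le (by linarith) ?_
      rw [div_le_iff₀ hpos] at hm
      linarith
    have h2 : n ≤ (g : ℝ) ^ m := h1.trans (by gcongr; exact Nat.le_ceil _)
    exact (Nat.cast_le (α := ℝ)).1 (by push_cast; exact h2)
  calc _ ≤ (law s β M).real {ω | ¬ Expands g ω} := by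
        refine measureReal_mono fun ω hω hexp => ?_
        have h1 := hexp.diameter_le hgm
        simp only [Set.mem_ofPred_eq, Nat.cast_lt] at hω
        omega
    _ ≤ _ := prob_not_expands_le hs0.le hβ.le g
    _ ≤ _ := by
        rw [sub_le_sub_iff_right, Real.exp_le_exp, ← hn]
        have hlog : Real.log (n + 1) ≤ β / 12 * n ^ h := by
          have h1 : Real.log (n + 1) ≤ Real.log (n ^ 2) :=
            Real.log_le_log (by linarith) (by nlinarith)
          rw [Real.log_pow] at h1
          rw [Real.norm_of_nonneg (Real.log_nonneg (by linarith)),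
            Real.norm_of_nonneg (by positivity)] at hlogN
          push_cast at h1
          linarith
        have hg : (g : ℝ) + 1 ≤ 3 * n ^ h := by
          have := Nat.ceil_lt_add_one (show 0 ≤ n ^ h by positivity)
          linarith
        have h1 : n * (n + 1) ^ g ≤ Real.exp (β / 4 * n ^ (2 * h)) := by
          calc n * (n + 1) ^ g ≤ (n + 1) * (n + 1) ^ g := by gcongr; linarith
            _ = Real.exp (((g : ℝ) + 1) * Real.log (n + 1)) := by
                rw [← pow_succ', ← Real.rpow_natCast, Real.rpow_def_of_pos (by linarith)]
                push_cast
                ring_nf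
            _ ≤ _ := by
                rw [Real.exp_le_exp]
                have h2 : n ^ (2 * h) = n ^ h * n ^ h := by
                  rw [← Real.rpow_add hn0]; ring_nf
                rw [h2]
                calc _ ≤ (3 * n ^ h) * (β / 12 * n ^ h) := by
                      gcongr
                      exact Real.log_nonneg (by linarith)
                  _ = _ := by ring
        have h2 : β * n ^ (-s) * (n / 2) = β / 2 * n ^ (2 * h) := by
          have : n ^ (2 * h) = n ^ (-s) * n := by
            conv_rhs => enter [2]; rw [← Real.rpow_one n]
            rw [← Real.rpow_add hn0]
            congr 1
            rw [hh]; ring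
          rw [this]; ring
        rw [neg_mul, h2, ← mul_assoc]
        calc _ ≤ Real.exp (β / 4 * n ^ (2 * h)) * Real.exp (-(β / 2 * n ^ (2 * h))) := by gcongr
          _ = _ := by rw [← Real.exp_add]; ring_nf

/-! ### Polylogarithmic upper bound when `s < 2` -/

/-- The configuration is bridged at the exponent `γ` above the scale `m₀` if every arc of length
`d > m₀` has an open pair whose ends are within `⌈d ^ γ⌉` of the two ends of the arc. -/
def Bridged {N : ℕ} (γ m₀ : ℝ) (ω : Config N) : Prop :=
  ∀ (x : ZMod N) (d : ℕ), d < N → m₀ < d → 2 * ⌈(d : ℝ) ^ γ⌉₊ + 1 ≤ d →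
    ∃ i j, i ≤ ⌈(d : ℝ) ^ γ⌉₊ ∧ j ≤ ⌈(d : ℝ) ^ γ⌉₊ ∧
      ω s(x + (i : ℕ), x + (d - j : ℕ)) = true

theorem eq_of_natCast_zmod_eq {N : ℕ} {a b : ℕ} (ha : a < N) (hb : b < N)
    (h : (a : ZMod N) = (b : ZMod N)) : a = b := by
  have := (ZMod.natCast_eq_natCast_iff' a b N).1 h
  rwa [Nat.mod_eq_of_lt ha, Nat.mod_eq_of_lt hb] at this

/-- The two end segments of an arc of length `d` consist of more than `d ^ γ` vertices each. For
`2 * γ > s` they are joined with large probability. -/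
theorem prob_not_bridge_le {s β γ : ℝ} (hs : 0 ≤ s) (hβ : 0 ≤ β) {N : ℕ} [NeZero N] (x : ZMod N)
    {d : ℕ} (hdN : d < N) (hd : 2 * ⌈(d : ℝ) ^ γ⌉₊ + 1 ≤ d) :
    (law s β N).real {ω | ∀ i j, i ≤ ⌈(d : ℝ) ^ γ⌉₊ → j ≤ ⌈(d : ℝ) ^ γ⌉₊ →
      ω s(x + (i : ℕ), x + (d - j : ℕ)) = false} ≤ Real.exp (-(β * (d : ℝ) ^ (2 * γ - s))) := by
  classical
  set m : ℕ := ⌈(d : ℝ) ^ γ⌉₊ with hm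
  have hd0 : (0 : ℝ) < d := by
    have : 0 < d := by omega
    exact_mod_cast this
  let A : Finset (ZMod N) := (Finset.range (m + 1)).image fun i : ℕ => x + (i : ZMod N)
  let B : Finset (ZMod N) := (Finset.range (m + 1)).image fun j : ℕ => x + ((d - j : ℕ) : ZMod N)
  have hA : A.card = m + 1 := by
    rw [Finset.card_image_of_injOn, Finset.card_range]
    intro i hi i' hi' h
    simp only [Finset.coe_range, Set.mem_Iio] at hi hi'
    exact eq_of_natCast_zmod_eq (by omega) (by omega) (add_left_cancel h)
  have hB : B.card = m + 1 := by
    rw [Finset.card_image_of_injOn, Finset.card_range]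
    intro i hi i' hi' h
    simp only [Finset.coe_range, Set.mem_Iio] at hi hi'
    have := eq_of_natCast_zmod_eq (by omega) (by omega) (add_left_cancel h)
    omega
  have hdisj : Disjoint A B := by
    rw [Finset.disjoint_left]
    intro v hvA hvB
    obtain ⟨i, hi, rfl⟩ := Finset.mem_image.1 hvA
    obtain ⟨j, hj, h⟩ := Finset.mem_image.1 hvB
    rw [Finset.mem_range] at hi hj
    have := eq_of_natCast_zmod_eq (by omega) (by omega) (add_left_cancel h)
    omega
  have hL : ∀ a ∈ A, ∀ b ∈ B, cycleDist a b ≤ d := by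
    intro a ha b hb
    obtain ⟨i, hi, rfl⟩ := Finset.mem_image.1 ha
    obtain ⟨j, hj, rfl⟩ := Finset.mem_image.1 hb
    rw [Finset.mem_range] at hi hj
    have h := cycleDist_add_natCast_le (x + (i : ZMod N)) (d - j - i)
    rw [add_assoc, ← Nat.cast_add, show i + (d - j - i) = d - j by omega] at h
    omega
  refine le_trans (measureReal_mono ?_ (measure_ne_top _ _))
    ((prob_forall_closed_between_le hs hβ hdisj hL).trans ?_)
  · intro ω hω a ha b hb
    obtain ⟨i, hi, rfl⟩ := Finset.mem_image.1 ha
    obtain ⟨j, hj, rfl⟩ := Finset.mem_image.1 hb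
    rw [Finset.mem_range] at hi hj
    exact hω i j (by omega) (by omega)
  · rw [Real.exp_le_exp, hA, hB, neg_mul, neg_le_neg_iff, mul_assoc]
    refine mul_le_mul_of_nonneg_left ?_ hβ
    have h1 : (d : ℝ) ^ γ ≤ ((m + 1 : ℕ) : ℝ) := by
      have := Nat.le_ceil ((d : ℝ) ^ γ)
      push_cast
      linarith
    calc (d : ℝ) ^ (2 * γ - s) = (d : ℝ) ^ (-s) * ((d : ℝ) ^ γ * (d : ℝ) ^ γ) := by
          rw [← Real.rpow_add hd0, ← Real.rpow_add hd0]; ring_nf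
      _ ≤ _ := by gcongr

theorem prob_not_bridged_le {s β γ m₀ : ℝ} (hs : 0 ≤ s) (hβ : 0 ≤ β) (hγ : 0 ≤ 2 * γ - s)
    (hm₀ : 0 ≤ m₀) {N : ℕ} [NeZero N] :
    (law s β N).real {ω | ¬ Bridged γ m₀ ω} ≤
      (N : ℝ) ^ 2 * Real.exp (-(β * m₀ ^ (2 * γ - s))) := by
  classical
  let Ds : Finset ℕ := (Finset.range N).filter fun d => m₀ < d ∧ 2 * ⌈(d : ℝ) ^ γ⌉₊ + 1 ≤ d
  have hsub : {ω : Config N | ¬ Bridged γ m₀ ω} ⊆ ⋃ q ∈ (Finset.univ : Finset (ZMod N)) ×ˢ Ds,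
      {ω | ∀ i j, i ≤ ⌈(q.2 : ℝ) ^ γ⌉₊ → j ≤ ⌈(q.2 : ℝ) ^ γ⌉₊ →
        ω s(q.1 + (i : ℕ), q.1 + (q.2 - j : ℕ)) = false} := by
    intro ω hω
    simp only [Set.mem_ofPred_eq, Bridged] at hω
    push Not at hω
    obtain ⟨x, d, h1, h2, h3, h4⟩ := hω
    simp only [Set.mem_iUnion]
    refine ⟨(x, d), by simp [Ds, h1, h2]; omega, fun i j hi hj => ?_⟩
    simpa using h4 i j hi hj
  calc _ ≤ _ := measureReal_mono hsub (measure_ne_top _ _)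
    _ ≤ _ := measureReal_biUnion_finset_le _ _
    _ ≤ ∑ _q ∈ (Finset.univ : Finset (ZMod N)) ×ˢ Ds,
        Real.exp (-(β * m₀ ^ (2 * γ - s))) := by
        refine Finset.sum_le_sum fun q hq => ?_
        simp only [Ds, Finset.mem_product, Finset.mem_univ, true_and, Finset.mem_filter,
          Finset.mem_range] at hq
        refine (prob_not_bridge_le hs hβ q.1 hq.1 hq.2.2).trans ?_
        rw [Real.exp_le_exp, neg_le_neg_iff]
        gcongr
        exact hq.2.1.le
    _ ≤ _ := by
        rw [Finset.sum_const, Finset.card_product, Finset.card_univ, ZMod.card, nsmul_eq_mul]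
        have h1 : N * Ds.card ≤ N ^ 2 := by
          rw [sq]
          refine Nat.mul_le_mul_left N ((Finset.card_filter_le _ _).trans ?_)
          simp
        gcongr
        exact_mod_cast h1

/-- A bridge reduces the distance between the ends of an arc of length `d` to two distances between
the ends of arcs of length at most `⌈d ^ γ⌉ ≤ d ^ γ'`. The factor `2` is absorbed by
`(log (d ^ γ')) ^ θ = γ' ^ θ * (log d) ^ θ`. -/
theorem Bridged.dist_le {N : ℕ} [NeZero N] {γ γ' θ m₁ : ℝ} {ω : Config N} (h : Bridged γ m₁ ω)
    (hγ' : 0 ≤ γ') (hθ0 : 0 ≤ θ) (hθ : 2 * γ' ^ θ ≤ 1) (hm₁ : 0 ≤ m₁)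
    (hlarge : ∀ d : ℕ, m₁ < d → 3 ≤ d ∧ 2 * ⌈(d : ℝ) ^ γ⌉₊ + 1 ≤ d ∧
      max (⌈(d : ℝ) ^ γ⌉₊ : ℝ) 3 ≤ (d : ℝ) ^ γ') (d : ℕ) :
    ∀ x : ZMod N, d < N →
      ((graph ω).dist x (x + d) : ℝ) + 1 ≤ (m₁ + 1) * Real.log (max (d : ℝ) 3) ^ θ := by
  have hlog3 : 1 ≤ Real.log 3 := by
    rw [Real.le_log_iff_exp_le (by norm_num)]
    exact Real.exp_one_lt_three.le
  induction d using Nat.strong_induction_on with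
  | _ d ih =>
    intro x hd
    rcases le_or_gt (d : ℝ) m₁ with hdm | hdm
    · have h1 : ((graph ω).dist x (x + d) : ℝ) ≤ d := by
        exact_mod_cast (dist_le_cycleDist ω _ _).trans (cycleDist_add_natCast_le x d)
      have h2 : 1 ≤ Real.log (max (d : ℝ) 3) ^ θ :=
        Real.one_le_rpow (hlog3.trans (Real.log_le_log (by norm_num) (le_max_right _ _))) hθ0
      nlinarith
    · obtain ⟨hd3, hd2, hmax⟩ := hlarge d hdm
      obtain ⟨i, j, hi, hj, hij⟩ := h x d hd hdm hd2
      have hd3' : (3 : ℝ) ≤ d := by exact_mod_cast hd3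
      have hdpos : (0 : ℝ) < d := by linarith
      have hlogd : 0 ≤ Real.log d := Real.log_nonneg (by linarith)
      have hstep : ∀ (k : ℕ), k ≤ ⌈(d : ℝ) ^ γ⌉₊ → ∀ y : ZMod N,
          ((graph ω).dist y (y + k) : ℝ) + 1 ≤ (m₁ + 1) * (γ' ^ θ * Real.log d ^ θ) := by
        intro k hk y
        refine (ih k (by omega) y (by omega)).trans ?_
        rw [← Real.mul_rpow hγ' hlogd]
        have hk' : (k : ℝ) ≤ (⌈(d : ℝ) ^ γ⌉₊ : ℝ) := by exact_mod_cast hk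
        have h1 : max (k : ℝ) 3 ≤ (d : ℝ) ^ γ' := (max_le_max_right 3 hk').trans hmax
        have h2 : Real.log (max (k : ℝ) 3) ≤ γ' * Real.log d := by
          rw [← Real.log_rpow hdpos]
          exact Real.log_le_log (by positivity) h1
        gcongr
        exact Real.log_nonneg (le_trans (by norm_num) (le_max_right (k : ℝ) 3))
      have hadj : (graph ω).dist (x + (i : ℕ)) (x + (d - j : ℕ)) ≤ 1 := by
        by_cases heq : x + ((i : ℕ) : ZMod N) = x + ((d - j : ℕ) : ZMod N)
        · simp [heq]
        · have hadj : (graph ω).Adj (x + (i : ℕ)) (x + (d - j : ℕ)) := ⟨heq, Or.inr hij⟩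
          exact (SimpleGraph.dist_eq_one_iff_adj.2 hadj).le
      have ht1 := (graph_connected ω).dist_triangle (u := x) (v := x + (i : ℕ)) (w := x + (d : ℕ))
      have ht2 := (graph_connected ω).dist_triangle (u := x + (i : ℕ)) (v := x + (d - j : ℕ))
        (w := x + (d : ℕ))
      have hi' := hstep i hi x
      have hj' := hstep j hj (x + (d - j : ℕ))
      rw [add_assoc, ← Nat.cast_add, Nat.sub_add_cancel (by omega)] at hj'
      have htot : ((graph ω).dist x (x + (d : ℕ)) : ℝ) ≤ (graph ω).dist x (x + (i : ℕ)) + 1 +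
          (graph ω).dist (x + (d - j : ℕ)) (x + (d : ℕ)) := by
        exact_mod_cast (show _ ≤ _ by omega)
      rw [max_eq_left hd3']
      have h4 : (m₁ + 1) * Real.log d ^ θ * (2 * γ' ^ θ) ≤ (m₁ + 1) * Real.log d ^ θ * 1 := by
        gcongr
      linarith

theorem tendsto_prob_diameter_gt_log_rpow {s β : ℝ} (hs0 : 0 < s) (hs : s < 2) (hβ : 0 < β) :
    ∃ δ : ℝ, Tendsto (fun N : ℕ+ => law s β N
      {ω | Real.log (N : ℝ) ^ δ < (diameter ω : ℝ)}) atTop (𝓝 0) := by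
  obtain ⟨γ, hγ1, hγ2⟩ := exists_between (show s / 2 < 1 by linarith)
  obtain ⟨γ', hγ'1, hγ'2⟩ := exists_between hγ2
  have hγ0 : 0 < γ := by linarith
  have hγ'0 : 0 < γ' := by linarith
  set θ : ℝ := Real.log 2 / (-Real.log γ') with hθ
  have hlogγ' : Real.log γ' < 0 := Real.log_neg hγ'0 hγ'2
  have hθ0 : 0 ≤ θ := div_nonneg (Real.log_nonneg (by norm_num)) (by linarith)
  have hθ2 : 2 * γ' ^ θ ≤ 1 := by
    rw [Real.rpow_def_of_pos hγ'0, show Real.log γ' * θ = -Real.log 2 by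
      rw [hθ]; field_simp [hlogγ'.ne], Real.exp_neg, Real.exp_log (by norm_num)]
    norm_num
  -- With `m₀ = (log N) ^ K` the bound `N ^ 2 * exp (-β * m₀ ^ (2 * γ - s))` for the failure of a
  -- bridge equals `exp (2 * log N - β * (log N) ^ 2)`.
  set K : ℝ := 2 / (2 * γ - s) with hK
  have hKpos : 0 < 2 * γ - s := by linarith
  have hK0 : 0 < K := by positivity
  -- The scale above which the numerical inequalities of the recursion hold.
  have hev : ∀ᶠ d : ℕ in atTop, 3 ≤ d ∧ 2 * ⌈(d : ℝ) ^ γ⌉₊ + 1 ≤ d ∧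
      max (⌈(d : ℝ) ^ γ⌉₊ : ℝ) 3 ≤ (d : ℝ) ^ γ' := by
    have hp : ∀ a : ℝ, 0 < a → ∀ᶠ d : ℕ in atTop, (3 : ℝ) ≤ (d : ℝ) ^ a := fun a ha =>
      ((tendsto_rpow_atTop ha).comp tendsto_natCast_atTop_atTop).eventually_ge_atTop 3
    filter_upwards [hp γ' hγ'0, hp (γ' - γ) (by linarith), hp (1 - γ') (by linarith),
      eventually_ge_atTop 3] with d h1 h2 h3 h4
    have hd0 : (0 : ℝ) < d := by
      have : 0 < d := by omega
      exact_mod_cast this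
    have h5 : (1 : ℝ) ≤ (d : ℝ) ^ γ := Real.one_le_rpow
      (by exact_mod_cast (show 1 ≤ d by omega)) hγ0.le
    have h6 : (d : ℝ) ^ γ' = (d : ℝ) ^ γ * (d : ℝ) ^ (γ' - γ) := by
      rw [← Real.rpow_add hd0]; ring_nf
    have h7 : (d : ℝ) = (d : ℝ) ^ γ' * (d : ℝ) ^ (1 - γ') := by
      rw [← Real.rpow_add hd0]
      simp
    have h8 := (Nat.ceil_lt_add_one (show 0 ≤ (d : ℝ) ^ γ by positivity)).le
    have h9 : (⌈(d : ℝ) ^ γ⌉₊ : ℝ) ≤ (d : ℝ) ^ γ' := by nlinarith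
    refine ⟨h4, ?_, max_le h9 h1⟩
    have h10 : (2 * ⌈(d : ℝ) ^ γ⌉₊ + 1 : ℝ) ≤ d := by nlinarith
    exact_mod_cast h10
  obtain ⟨d₀, hd₀⟩ := eventually_atTop.1 hev
  refine ⟨K + 1 + θ, ?_⟩
  have hlogt : Tendsto (fun N : ℕ => Real.log (N : ℝ)) atTop atTop :=
    Real.tendsto_log_atTop.comp tendsto_natCast_atTop_atTop
  refine tendsto_law_of_le
    (b := fun N => Real.exp (Real.log N * (2 - β * Real.log N))) ?_ ?_
  · refine Real.tendsto_exp_atBot.comp (hlogt.atTop_mul_atBot₀ ?_)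
    have h1 := tendsto_const_nhds (x := (2 : ℝ)) (f := atTop (α := ℕ)) |>.add_atBot
      (hlogt.const_mul_atTop_of_neg (show -β < 0 by linarith))
    refine h1.congr fun N => by ring
  filter_upwards [hlogt.eventually_ge_atTop ((d₀ : ℝ) + 2), eventually_ge_atTop 3]
    with N hlogN hN3 M hM
  subst hM
  set l : ℝ := Real.log ((M : ℕ) : ℝ) with hl
  have hl1 : 1 ≤ l := by linarith [Nat.cast_nonneg (α := ℝ) d₀]
  have hl0 : 0 < l := by linarith
  have hNpos : (0 : ℝ) < ((M : ℕ) : ℝ) := Nat.cast_pos.2 M.pos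
  set m₀ : ℝ := l ^ K with hm₀
  have hm₀0 : 0 ≤ m₀ := by positivity
  set m₁ : ℝ := m₀ + d₀ with hm₁
  have hm₁0 : 0 ≤ m₁ := by positivity
  calc _ ≤ (law s β M).real {ω | ¬ Bridged γ m₁ ω} := by
        refine measureReal_mono (fun ω hω hbr => ?_) (measure_ne_top _ _)
        rw [Set.mem_ofPred_eq] at hω
        refine absurd hω (not_lt.2 ?_)
        have hdist := hbr.dist_le hγ'0.le hθ0 hθ2 hm₁0 fun d hd => hd₀ d (by
          have : (d₀ : ℝ) < d := by linarith
          exact_mod_cast this.le)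
        obtain ⟨x, y, hxy⟩ := (graph ω).exists_dist_eq_diam
        have h1 := hdist (y - x).val x (ZMod.val_lt _)
        rw [ZMod.natCast_zmod_val, add_sub_cancel, hxy] at h1
        have h2 : Real.log (max ((y - x).val : ℝ) 3) ≤ l := by
          refine Real.log_le_log (by positivity) (max_le ?_ ?_)
          · exact_mod_cast (ZMod.val_lt (y - x)).le
          · exact_mod_cast hN3
        have h3 : 0 ≤ Real.log (max ((y - x).val : ℝ) 3) :=
          Real.log_nonneg (le_trans (by norm_num) (le_max_right _ _))
        have h4 : m₁ + 1 ≤ l ^ (K + 1) := by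
          have h5 : 1 ≤ m₀ := Real.one_le_rpow hl1 hK0.le
          rw [Real.rpow_add hl0, Real.rpow_one, ← hm₀]
          have h6 : m₀ * (d₀ + 2) ≤ m₀ * l := by gcongr
          have h7 : (d₀ : ℝ) ≤ m₀ * d₀ := le_mul_of_one_le_left (Nat.cast_nonneg _) h5
          rw [hm₁]
          linarith
        calc ((diameter ω : ℕ) : ℝ) ≤ (m₁ + 1) * Real.log (max ((y - x).val : ℝ) 3) ^ θ := by
              rw [diameter]
              linarith
          _ ≤ l ^ (K + 1) * l ^ θ := by gcongr
          _ = l ^ (K + 1 + θ) := (Real.rpow_add hl0 _ _).symm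
    _ ≤ _ := prob_not_bridged_le hs0.le hβ.le hKpos.le hm₁0
    _ ≤ ((M : ℕ) : ℝ) ^ 2 * Real.exp (-(β * m₀ ^ (2 * γ - s))) := by
        gcongr
        rw [hm₁]
        linarith [Nat.cast_nonneg (α := ℝ) d₀]
    _ = _ := by
        have h1 : m₀ ^ (2 * γ - s) = l ^ 2 := by
          rw [hm₀, ← Real.rpow_mul hl0.le, hK, div_mul_cancel₀ _ hKpos.ne']
          exact Real.rpow_two l
        have h2 : ((M : ℕ) : ℝ) ^ 2 = Real.exp (2 * l) := by
          rw [mul_comm, Real.exp_mul, hl, Real.exp_log hNpos]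
          exact (Real.rpow_two _).symm
        rw [h1, h2, ← Real.exp_add]
        ring_nf

/-! ### Cutting the cycle into blocks -/

/-- If a function on the vertices changes by at most `1 + f u v` along every edge `uv`, then along
a path it changes by at most the length of the path plus the sum of `f` over all pairs, because
a path uses every edge at most once. -/
theorem abs_sub_le_length_add_sum {V : Type*} [Fintype V] {H : SimpleGraph V} {G : V → ℤ}
    {f : V → V → ℕ} (hf : ∀ u v, H.Adj u v → |G u - G v| ≤ 1 + f u v) {x y : V} (p : H.Walk x y)
    (hp : p.IsPath) : |G x - G y| ≤ p.length + ∑ q : V × V, (f q.1 q.2 : ℤ) := by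
  classical
  have h1 : ∀ {x y : V} (p : H.Walk x y),
      |G x - G y| ≤ p.length + (p.darts.map fun d => (f d.fst d.snd : ℤ)).sum := by
    intro x y p
    induction p with
    | nil => simp
    | @cons u v w h p ih =>
      have h2 := hf u v h
      simp only [SimpleGraph.Walk.length_cons, SimpleGraph.Walk.darts_cons, List.map_cons,
        List.sum_cons]
      rw [abs_le] at *
      push_cast
      constructor <;> linarith
  have h2 : (p.darts.map fun d => (f d.fst d.snd : ℤ)).sum ≤ ∑ q : V × V, (f q.1 q.2 : ℤ) := by
    have hnd : (p.darts.map SimpleGraph.Dart.toProd).Nodup :=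
      (SimpleGraph.Walk.darts_nodup_of_support_nodup hp.support_nodup).map
        SimpleGraph.Dart.toProd_injective
    have h3 := List.sum_toFinset (fun q : V × V => (f q.1 q.2 : ℤ)) hnd
    rw [List.map_map] at h3
    refine le_trans (le_of_eq h3.symm) ?_
    exact Finset.sum_le_univ_sum_of_nonneg fun _ => by positivity
  linarith [h1 p]

/-- The graph on a block of `m + 1` consecutive vertices given by the pairs inside the block. -/
def blockGraph {m : ℕ} (η : Sym2 (Fin (m + 1)) → Bool) : SimpleGraph (Fin (m + 1)) where
  Adj a b := a ≠ b ∧ ((a : ℕ) + 1 = b ∨ (b : ℕ) + 1 = a ∨ η s(a, b) = true)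
  symm := ⟨fun a b h => ⟨h.1.symm, by rw [Sym2.eq_swap]; tauto⟩⟩
  loopless := ⟨fun _ h => h.1 rfl⟩

theorem blockGraph_connected {m : ℕ} (η : Sym2 (Fin (m + 1)) → Bool) :
    (blockGraph η).Connected := by
  refine (SimpleGraph.pathGraph_connected m).mono fun a b h => ?_
  have h1 := h.ne
  rw [SimpleGraph.pathGraph_adj] at h
  exact ⟨h1, by tauto⟩

/-- The distance between the two end vertices of a block inside the block. -/
noncomputable def blockLen {m : ℕ} (η : Sym2 (Fin (m + 1)) → Bool) : ℕ :=
  (blockGraph η).dist 0 (Fin.last m)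

theorem blockGraph_abs_dist_sub_le {m : ℕ} (η : Sym2 (Fin (m + 1)) → Bool) {a b : Fin (m + 1)}
    (h : (blockGraph η).Adj a b) :
    |((blockGraph η).dist 0 a : ℤ) - (blockGraph η).dist 0 b| ≤ 1 := by
  have h1 := h.diff_dist_adj (u := 0)
  rw [abs_le]
  omega

theorem blockLen_le {m : ℕ} (η : Sym2 (Fin (m + 1)) → Bool) : blockLen η ≤ m := by
  have key : ∀ k (hk : k < m + 1), (blockGraph η).dist 0 ⟨k, hk⟩ ≤ k := by
    intro k
    induction k with
    | zero => intro hk; simp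
    | succ k ih =>
      intro hk
      have h1 := ih (by omega)
      have hadj : (blockGraph η).Adj ⟨k, by omega⟩ ⟨k + 1, hk⟩ :=
        ⟨by simp, Or.inl rfl⟩
      have := blockGraph_abs_dist_sub_le η hadj
      rw [abs_le] at this
      omega
  exact key m (by omega)

section Block

variable {N : ℕ} (ω : Config N) (m : ℕ)

/-- The vertex number `a` of the block number `i`. -/
def blockVertex (N m i : ℕ) (a : Fin (m + 1)) : ZMod N := ((i * (m + 1) + a : ℕ) : ZMod N)

/-- The configuration inside the block number `i`, which consists of the vertices from
`i * (m + 1)` to `i * (m + 1) + m`. -/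
def blockConfig (i : ℕ) : Sym2 (Fin (m + 1)) → Bool :=
  fun e => ω (e.map (blockVertex N m i))

/-- The length of a walk through the first `j` blocks, including the steps from each block to the
next one. -/
noncomputable def blockSum (j : ℕ) : ℕ :=
  ∑ i ∈ Finset.range j, (blockLen (blockConfig ω m i) + 1)

/-- The length of the circuit through the `N / (m + 1)` blocks and the remaining vertices. -/
noncomputable def circuitLen : ℕ := blockSum ω m (N / (m + 1)) + N % (m + 1)

/-- The number of steps from `0` to the start of the block of `v`, going through the blocks, plus
the distance from there to `v` inside the block. Past the last block, single steps are counted. -/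
noncomputable def potential (v : ℕ) : ℤ :=
  if v < N / (m + 1) * (m + 1) then
    blockSum ω m (v / (m + 1)) +
      (blockGraph (blockConfig ω m (v / (m + 1)))).dist 0 (Fin.ofNat (m + 1) v)
  else blockSum ω m (N / (m + 1)) + (v - (N / (m + 1) * (m + 1) : ℕ) : ℤ)

/-- The vertices `x` and `y` lie in one and the same of the `N / (m + 1)` blocks. -/
def SameBlock (x y : ZMod N) : Prop :=
  x.val / (m + 1) = y.val / (m + 1) ∧ x.val / (m + 1) < N / (m + 1)

open Classical in
/-- The total length of the open pairs not inside a block, each counted twice. -/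
noncomputable def crossLen [NeZero N] : ℕ :=
  ∑ q : ZMod N × ZMod N,
    if ω s(q.1, q.2) = true ∧ ¬ SameBlock m q.1 q.2 then cycleDist q.1 q.2 else 0

variable {m}

theorem blockSum_succ (j : ℕ) :
    blockSum ω m (j + 1) = blockSum ω m j + (blockLen (blockConfig ω m j) + 1) :=
  Finset.sum_range_succ _ _

theorem potential_block {i a : ℕ} (hi : i < N / (m + 1)) (ha : a < m + 1) :
    potential ω m (i * (m + 1) + a) =
      blockSum ω m i + (blockGraph (blockConfig ω m i)).dist 0 ⟨a, ha⟩ := by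
  have h1 : (i * (m + 1) + a) / (m + 1) = i := by
    rw [add_comm, Nat.add_mul_div_right _ _ (Nat.succ_pos m), Nat.div_eq_of_lt ha, zero_add]
  have h2 : Fin.ofNat (m + 1) (i * (m + 1) + a) = ⟨a, ha⟩ := by
    ext
    simp [Fin.ofNat, Nat.mod_eq_of_lt ha]
  have h3 : i * (m + 1) + a < N / (m + 1) * (m + 1) := by
    have := Nat.mul_le_mul_right (m + 1) (Nat.succ_le_of_lt hi)
    rw [Nat.succ_mul] at this
    omega
  rw [potential, if_pos h3, h1, h2]

theorem potential_start {i : ℕ} (hi : i ≤ N / (m + 1)) :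
    potential ω m (i * (m + 1)) = blockSum ω m i := by
  rcases hi.lt_or_eq with h | h
  · have := potential_block ω (a := 0) h (Nat.succ_pos m)
    simpa using this
  · rw [potential, if_neg (by rw [h]; omega), h]
    simp

theorem potential_zero : potential ω m 0 = 0 := by
  have := potential_start ω (m := m) (Nat.zero_le _)
  simpa [blockSum] using this

theorem potential_card : potential ω m N = circuitLen ω m := by
  have h := Nat.div_add_mod' N (m + 1)
  rw [potential, if_neg (by omega), circuitLen]
  push_cast
  have h' : ((N / (m + 1) : ℕ) : ℤ) * (m + 1) + (N % (m + 1) : ℕ) = N := by exact_mod_cast h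
  push_cast at h'
  linarith

theorem abs_potential_succ_sub_le (v : ℕ) :
    |potential ω m (v + 1) - potential ω m v| ≤ 1 := by
  by_cases hv : v < N / (m + 1) * (m + 1)
  · have hi : v / (m + 1) < N / (m + 1) := Nat.div_lt_of_lt_mul (by rwa [mul_comm])
    have hva := Nat.div_add_mod' v (m + 1)
    have ha : v % (m + 1) < m + 1 := Nat.mod_lt _ (Nat.succ_pos m)
    generalize v / (m + 1) = i at *
    generalize v % (m + 1) = a at *
    rw [← hva, potential_block ω hi ha]
    by_cases ha' : a + 1 < m + 1
    · rw [add_assoc, potential_block ω hi ha']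
      have hadj : (blockGraph (blockConfig ω m i)).Adj ⟨a + 1, ha'⟩ ⟨a, ha⟩ :=
        ⟨by simp, Or.inr (Or.inl rfl)⟩
      have := blockGraph_abs_dist_sub_le _ hadj
      rw [abs_le] at *
      constructor <;> linarith
    · obtain rfl : a = m := by omega
      have h1 : i * (a + 1) + a + 1 = (i + 1) * (a + 1) := by ring
      rw [h1, potential_start ω hi, blockSum_succ, blockLen]
      have h2 : (⟨a, ha⟩ : Fin (a + 1)) = Fin.last a := rfl
      rw [h2]
      push_cast
      rw [abs_le]
      constructor <;> linarith
  · rw [potential, potential, if_neg hv, if_neg (by omega)]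
    push_cast
    rw [abs_le]
    constructor <;> linarith

/-- An open pair inside a block is an edge of the block graph. -/
theorem abs_potential_sub_le_of_sameBlock [NeZero N] {x y : ZMod N} (h : SameBlock m x y)
    (hxy : x ≠ y) (ho : ω s(x, y) = true) : |potential ω m x.val - potential ω m y.val| ≤ 1 := by
  have hx := Nat.div_add_mod' x.val (m + 1)
  have hy := Nat.div_add_mod' y.val (m + 1)
  have hax : x.val % (m + 1) < m + 1 := Nat.mod_lt _ (Nat.succ_pos m)
  have hay : y.val % (m + 1) < m + 1 := Nat.mod_lt _ (Nat.succ_pos m)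
  obtain ⟨h1, h2⟩ := h
  rw [← h1] at hy
  set i := x.val / (m + 1)
  rw [← hx, ← hy, potential_block ω h2 hax, potential_block ω h2 hay]
  have hadj : (blockGraph (blockConfig ω m i)).Adj ⟨_, hax⟩ ⟨_, hay⟩ := by
    refine ⟨fun heq => hxy (ZMod.val_injective N ?_), Or.inr (Or.inr ?_)⟩
    · rw [← hx, ← hy, (Fin.mk.injEq _ _ _ _).mp heq]
    · simp only [blockConfig, Sym2.map_mk, blockVertex]
      rw [hx, hy, ZMod.natCast_zmod_val, ZMod.natCast_zmod_val]
      exact ho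
  have := blockGraph_abs_dist_sub_le _ hadj
  rw [abs_le] at *
  constructor <;> linarith

/-- Lower bound for the diameter: the distance of the potential on the circle of length
`circuitLen` changes by at most `1` along the steps of the cycle and the pairs inside blocks. -/
theorem circuitLen_le [NeZero N] :
    circuitLen ω m ≤ 2 * diameter ω + 2 * crossLen ω m + 1 := by
  classical
  obtain ⟨S, hS⟩ : ∃ S : ℤ, S = (circuitLen ω m : ℤ) := ⟨_, rfl⟩
  -- The distance on the circle from the potential at `0` to the potential at `x`.
  let G : ZMod N → ℤ := fun x => min (potential ω m x.val) (S - potential ω m x.val)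
  have hG : ∀ x, |G (x + 1) - G x| ≤ 1 := by
    intro x
    have h1 := abs_potential_succ_sub_le ω (m := m) x.val
    have h2 : (x + 1).val = (x.val + 1) % N := by
      rw [← ZMod.val_natCast]
      push_cast
      rw [ZMod.natCast_zmod_val]
    have h3 := x.val_lt
    have h0 := potential_zero ω (m := m)
    have hN := potential_card ω (m := m)
    rw [← hS] at hN
    simp only [G]
    rw [abs_le] at *
    rcases lt_or_ge (x.val + 1) N with h | h
    · rw [h2, Nat.mod_eq_of_lt h]
      constructor <;> omega
    · have h4 : x.val + 1 = N := by omega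
      rw [h4, hN] at h1
      rw [h2, h4, Nat.mod_self, h0]
      constructor <;> omega
  have hadj : ∀ u v, (graph ω).Adj u v → |G u - G v| ≤ 1 +
      (if ω s(u, v) = true ∧ ¬ SameBlock m u v then cycleDist u v else 0 : ℕ) := by
    rintro u v ⟨hne, h⟩
    have hlip := abs_sub_le_cycleDist hG u v
    by_cases h1 : cycleDist u v = 1
    · rw [h1] at hlip
      refine hlip.trans ?_
      push_cast
      have : (0 : ℤ) ≤ ((if ω s(u, v) = true ∧ ¬ SameBlock m u v then cycleDist u v else 0 : ℕ)) :=
        Int.natCast_nonneg _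
      push_cast at this
      linarith
    · have ho := h.resolve_left h1
      by_cases hb : SameBlock m u v
      · have := abs_potential_sub_le_of_sameBlock ω hb hne ho
        simp only [hb, not_true_eq_false, and_false, if_false, G]
        rw [abs_le] at *
        constructor <;> omega
      · rw [if_pos ⟨ho, hb⟩]
        linarith
  -- The potential takes the value `⌊S / 2⌋`, by its small steps.
  obtain ⟨v, hvN, hv⟩ : ∃ v < N, potential ω m v = S / 2 := by
    have hSnn : 0 ≤ S := by rw [hS]; exact Int.natCast_nonneg _
    have hex : ∃ v, S / 2 ≤ potential ω m v := ⟨N, by rw [potential_card]; omega⟩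
    have h0 := potential_zero ω (m := m)
    have hspec := Nat.find_spec hex
    have hle : Nat.find hex ≤ N := Nat.find_min' hex (by rw [potential_card]; omega)
    have hval : potential ω m (Nat.find hex) = S / 2 := by
      rcases Nat.eq_zero_or_pos (Nat.find hex) with h | h
      · rw [h] at hspec ⊢
        omega
      · obtain ⟨w, hw⟩ := Nat.exists_eq_succ_of_ne_zero h.ne'
        have h1 := Nat.find_min hex (m := w) (by omega)
        have h2 := abs_potential_succ_sub_le ω (m := m) w
        rw [hw] at hspec ⊢
        rw [abs_le] at h2
        simp only [Nat.succ_eq_add_one] at *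
        omega
    rcases hle.lt_or_eq with h | h
    · exact ⟨_, h, hval⟩
    · rw [h, potential_card] at hval
      exact ⟨0, NeZero.pos N, by rw [h0]; omega⟩
  obtain ⟨p, hp, hl⟩ :=
    (graph_connected ω).exists_path_of_dist 0 (v : ZMod N)
  have h := abs_sub_le_length_add_sum hadj p hp
  have hdiam := dist_le_diameter ω 0 (v : ZMod N)
  rw [← hl] at hdiam
  have hGv : G (v : ZMod N) = S / 2 := by
    simp only [G, ZMod.val_natCast, Nat.mod_eq_of_lt hvN, hv]
    omega
  have hG0 : G 0 = min 0 S := by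
    simp only [G, ZMod.val_zero, potential_zero]
    simp
  rw [hGv, hG0, abs_le, ← Nat.cast_sum] at h
  change _ ∧ _ ≤ (p.length : ℤ) + (crossLen ω m : ℤ) at h
  have h1 := h.1
  change -((p.length : ℤ) + (crossLen ω m : ℤ)) ≤ _ at h1
  omega

theorem dist_blockStart_succ_le [NeZero N] (i : ℕ) :
    (graph ω).dist ((i * (m + 1) : ℕ) : ZMod N) (((i + 1) * (m + 1) : ℕ) : ZMod N) ≤
      blockLen (blockConfig ω m i) + 1 := by
  let G : Fin (m + 1) → ℤ := fun a => (graph ω).dist (blockVertex N m i 0) (blockVertex N m i a)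
  have hG : ∀ a b, (blockGraph (blockConfig ω m i)).Adj a b →
      |G a - G b| ≤ 1 + ((fun _ _ => 0 : Fin (m + 1) → Fin (m + 1) → ℕ) a b : ℤ) := by
    rintro a b ⟨hne, h⟩
    have h1 : (graph ω).dist (blockVertex N m i a) (blockVertex N m i b) ≤ 1 := by
      rcases h with h | h | h
      · have := dist_succ_le ω (blockVertex N m i a)
        rw [SimpleGraph.dist_comm] at this
        convert this using 2
        simp only [blockVertex, ← h]
        push_cast
        ring
      · have := dist_succ_le ω (blockVertex N m i b)
        convert this using 2
        simp only [blockVertex, ← h]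
        push_cast
        ring
      · by_cases heq : blockVertex N m i a = blockVertex N m i b
        · simp [heq]
        · have hadj : (graph ω).Adj (blockVertex N m i a) (blockVertex N m i b) :=
            ⟨heq, Or.inr h⟩
          exact (SimpleGraph.dist_eq_one_iff_adj.2 hadj).le
    have h2 := (graph_connected ω).dist_triangle (u := blockVertex N m i 0)
      (v := blockVertex N m i a) (w := blockVertex N m i b)
    have h3 := (graph_connected ω).dist_triangle (u := blockVertex N m i 0)
      (v := blockVertex N m i b) (w := blockVertex N m i a)
    rw [(graph ω).dist_comm (u := blockVertex N m i b)] at h3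
    simp only [G]
    rw [abs_le]
    push_cast
    constructor <;> omega
  obtain ⟨p, hp, hl⟩ := (blockGraph_connected (blockConfig ω m i)).exists_path_of_dist 0
    (Fin.last m)
  have h1 := abs_sub_le_length_add_sum hG p hp
  simp only [G, SimpleGraph.dist_self, hl, Nat.cast_zero, Finset.sum_const_zero] at h1
  have h2 := dist_succ_le ω (blockVertex N m i (Fin.last m))
  have h3 := (graph_connected ω).dist_triangle (u := blockVertex N m i 0)
    (v := blockVertex N m i (Fin.last m)) (w := blockVertex N m i (Fin.last m) + 1)
  rw [(graph ω).dist_comm] at h2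
  have h4 : (((i + 1) * (m + 1) : ℕ) : ZMod N) = blockVertex N m i (Fin.last m) + 1 := by
    simp only [blockVertex, Fin.val_last]
    push_cast
    ring
  have h5 : ((i * (m + 1) : ℕ) : ZMod N) = blockVertex N m i 0 := by
    simp [blockVertex]
  rw [h4, h5, blockLen]
  rw [abs_le] at h1
  omega

theorem dist_blockStart_le [NeZero N] {i j : ℕ} (hij : i ≤ j) :
    blockSum ω m i + (graph ω).dist ((i * (m + 1) : ℕ) : ZMod N) ((j * (m + 1) : ℕ) : ZMod N) ≤
      blockSum ω m j := by
  induction j, hij using Nat.le_induction with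
  | base => simp
  | succ j _ ih =>
    have h1 := dist_blockStart_succ_le ω (m := m) j
    have h2 := (graph_connected ω).dist_triangle (u := ((i * (m + 1) : ℕ) : ZMod N))
      (v := ((j * (m + 1) : ℕ) : ZMod N)) (w := (((j + 1) * (m + 1) : ℕ) : ZMod N))
    rw [blockSum_succ]
    omega

/-- Upper bound for the diameter: two starts of blocks are joined by the two arcs of the circuit. -/
theorem two_mul_diameter_le [NeZero N] : 2 * diameter ω ≤ circuitLen ω m + 4 * (m + 1) := by
  set k := N / (m + 1) with hk
  have hstart : ∀ i j, i ≤ j → j ≤ k →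
      2 * (graph ω).dist ((i * (m + 1) : ℕ) : ZMod N) ((j * (m + 1) : ℕ) : ZMod N) ≤
        circuitLen ω m := by
    intro i j hij hjk
    have h1 := dist_blockStart_le ω (m := m) hij
    have h2 := dist_blockStart_le ω (m := m) (Nat.zero_le i)
    have h3 := dist_blockStart_le ω (m := m) hjk
    have h4 := (dist_le_cycleDist ω _ _).trans
      (cycleDist_add_natCast_le ((k * (m + 1) : ℕ) : ZMod N) (N % (m + 1)))
    rw [← Nat.cast_add, hk, Nat.div_add_mod', ← hk, ZMod.natCast_self] at h4
    rw [(graph ω).dist_comm] at h2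
    simp only [zero_mul, Nat.cast_zero] at h2
    have h5 := (graph_connected ω).dist_triangle (u := ((i * (m + 1) : ℕ) : ZMod N)) (v := 0)
      (w := ((j * (m + 1) : ℕ) : ZMod N))
    have h6 := (graph_connected ω).dist_triangle (u := (0 : ZMod N))
      (v := ((k * (m + 1) : ℕ) : ZMod N)) (w := ((j * (m + 1) : ℕ) : ZMod N))
    rw [(graph ω).dist_comm (u := 0) (v := ((k * (m + 1) : ℕ) : ZMod N)),
      (graph ω).dist_comm (u := ((k * (m + 1) : ℕ) : ZMod N)) (v := ((j * (m + 1) : ℕ) : ZMod N))]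
      at h6
    have h7 : circuitLen ω m = blockSum ω m k + N % (m + 1) := rfl
    omega
  have hnear : ∀ x : ZMod N, ∃ i ≤ k, (graph ω).dist ((i * (m + 1) : ℕ) : ZMod N) x ≤ m + 1 := by
    intro x
    refine ⟨x.val / (m + 1), Nat.div_le_div_right x.val_lt.le, ?_⟩
    have h1 := (dist_le_cycleDist ω _ _).trans
      (cycleDist_add_natCast_le ((x.val / (m + 1) * (m + 1) : ℕ) : ZMod N) (x.val % (m + 1)))
    rw [← Nat.cast_add, Nat.div_add_mod', ZMod.natCast_zmod_val] at h1
    exact h1.trans (Nat.mod_lt _ (Nat.succ_pos m)).le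
  obtain ⟨x, y, hxy⟩ := (graph ω).exists_dist_eq_diam
  obtain ⟨i, hi, hx⟩ := hnear x
  obtain ⟨j, hj, hy⟩ := hnear y
  have h1 : 2 * (graph ω).dist ((i * (m + 1) : ℕ) : ZMod N) ((j * (m + 1) : ℕ) : ZMod N) ≤
      circuitLen ω m := by
    rcases le_total i j with h | h
    · exact hstart i j h hj
    · rw [SimpleGraph.dist_comm]
      exact hstart j i h hi
  have h2 := (graph_connected ω).dist_triangle (u := x) (v := ((i * (m + 1) : ℕ) : ZMod N))
    (w := y)
  have h3 := (graph_connected ω).dist_triangle (u := ((i * (m + 1) : ℕ) : ZMod N))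
    (v := ((j * (m + 1) : ℕ) : ZMod N)) (w := y)
  rw [(graph ω).dist_comm (u := x) (v := ((i * (m + 1) : ℕ) : ZMod N))] at h2
  rw [diameter, ← hxy]
  omega

end Block

/-! ### The law of the blocks -/

/-- The probability that a pair inside a block is open. -/
noncomputable def blockProb (s β : ℝ) (m : ℕ) (e : Sym2 (Fin (m + 1))) : unitInterval :=
  Sym2.lift ⟨fun a b : Fin (m + 1) => bondProb s β (((a : ℕ) : ℤ) - (b : ℕ)).natAbs,
    fun a b => by beta_reduce; rw [← Int.natAbs_neg, neg_sub]⟩ e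

@[simp] theorem blockProb_mk (s β : ℝ) (m : ℕ) (a b : Fin (m + 1)) :
    blockProb s β m s(a, b) = bondProb s β (((a : ℕ) : ℤ) - (b : ℕ)).natAbs := rfl

/-- The expected contribution of a block of `m + 1` vertices to `circuitLen`. -/
noncomputable def blockMean (s β : ℝ) (m : ℕ) : ℝ :=
  ∫ η, ((blockLen η : ℝ) + 1) ∂bitLaw (blockProb s β m)

theorem blockMean_le (s β : ℝ) (m : ℕ) : blockMean s β m ≤ m + 1 := by
  calc blockMean s β m ≤ ∫ _η, ((m : ℝ) + 1) ∂bitLaw (blockProb s β m) := by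
        refine integral_mono .of_finite .of_finite fun η => ?_
        have : (blockLen η : ℝ) ≤ m := by exact_mod_cast blockLen_le η
        simpa using this
    _ = _ := by simp

theorem blockMean_nonneg (s β : ℝ) (m : ℕ) : 0 ≤ blockMean s β m :=
  integral_nonneg fun _ => by positivity

theorem succ_mul_le_of_lt_div {N m i : ℕ} (hi : i < N / (m + 1)) : (i + 1) * (m + 1) ≤ N :=
  (Nat.mul_le_mul_right (m + 1) hi).trans (Nat.div_mul_le_self N (m + 1))

section BlockLaw

variable {N m : ℕ}

theorem val_blockVertex {i : ℕ} (hi : (i + 1) * (m + 1) ≤ N) (a : Fin (m + 1)) :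
    (blockVertex N m i a).val = i * (m + 1) + a := by
  have := a.isLt
  rw [blockVertex, ZMod.val_natCast, Nat.mod_eq_of_lt]
  rw [Nat.succ_mul] at hi
  omega

theorem blockVertex_inj {i j : ℕ} (hi : (i + 1) * (m + 1) ≤ N)
    (hj : (j + 1) * (m + 1) ≤ N) {a b : Fin (m + 1)}
    (h : blockVertex N m i a = blockVertex N m j b) : i = j ∧ a = b := by
  have h1 := congrArg ZMod.val h
  rw [val_blockVertex hi, val_blockVertex hj] at h1
  have h2 : ∀ (i : ℕ) (a : Fin (m + 1)), (i * (m + 1) + a) / (m + 1) = i := fun i a => by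
    rw [add_comm, Nat.add_mul_div_right _ _ (Nat.succ_pos m), Nat.div_eq_of_lt a.isLt, zero_add]
  have h3 : i = j := by rw [← h2 i a, ← h2 j b, h1]
  subst h3
  exact ⟨rfl, Fin.ext (by omega)⟩

theorem blockVertex_injective {i : ℕ} (hi : (i + 1) * (m + 1) ≤ N) :
    Function.Injective (blockVertex N m i) := fun _ _ h => (blockVertex_inj hi hi h).2

variable [NeZero N]

/-- In a cycle of at least twice the length of a block the wrap-around does not shorten distances
inside a block, so that its law depends only on its length. -/
theorem map_blockConfig (s β : ℝ) {i : ℕ} (hi : (i + 1) * (m + 1) ≤ N) (hN : 2 * (m + 1) ≤ N) :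
    (law s β N).map (fun ω => blockConfig ω m i) = bitLaw (blockProb s β m) := by
  have h := map_bitLaw_comp (pairProb (N := N) s β)
    (Sym2.map.injective (blockVertex_injective (N := N) (m := m) hi))
  rw [law_eq_bitLaw]
  refine h.trans (congrArg _ (funext fun e => ?_))
  induction e using Sym2.ind with
  | _ a b =>
    simp only [Function.comp_apply, Sym2.map_mk, pairProb_mk, blockProb_mk]
    congr 1
    have h1 := cycleDist_eq_min (blockVertex N m i a) (blockVertex N m i b)
    rw [val_blockVertex hi, val_blockVertex hi] at h1
    have ha := a.isLt
    have hb := b.isLt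
    push_cast at h1
    rw [show (i : ℤ) * (m + 1) + (a : ℕ) - (i * (m + 1) + (b : ℕ)) = (a : ℕ) - (b : ℕ) by ring,
      Int.abs_eq_natAbs] at h1
    omega

theorem integral_blockConfig (s β : ℝ) {i : ℕ} (hi : (i + 1) * (m + 1) ≤ N)
    (hN : 2 * (m + 1) ≤ N) (f : (Sym2 (Fin (m + 1)) → Bool) → ℝ) :
    ∫ ω, f (blockConfig ω m i) ∂law s β N = ∫ η, f η ∂bitLaw (blockProb s β m) := by
  rw [← map_blockConfig s β hi hN, integral_map (Measurable.of_discrete.aemeasurable)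
    (Measurable.of_discrete.aestronglyMeasurable)]

theorem indepFun_blockConfig (s β : ℝ) {i j : ℕ} (hij : i ≠ j) (hi : (i + 1) * (m + 1) ≤ N)
    (hj : (j + 1) * (m + 1) ≤ N) (f : (Sym2 (Fin (m + 1)) → Bool) → ℝ) :
    IndepFun (fun ω : Config N => f (blockConfig ω m i)) (fun ω => f (blockConfig ω m j))
      (law s β N) := by
  classical
  rw [law_eq_bitLaw]
  have hdep : ∀ l, DependsOn (fun ω : Config N => f (blockConfig ω m l))
      ((Finset.univ.image (Sym2.map (blockVertex N m l)) : Finset (Sym2 (ZMod N))) : Set _) := by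
    intro l ω ω' h
    have : blockConfig ω m l = blockConfig ω' m l := funext fun e =>
      h _ (by simp only [Finset.coe_image, Finset.coe_univ, Set.image_univ, Set.mem_range]
              exact ⟨e, rfl⟩)
    simp only [this]
  refine indepFun_of_dependsOn _ ?_ (hdep i) (hdep j)
  rw [Finset.disjoint_left]
  intro e he he'
  obtain ⟨e₁, -, rfl⟩ := Finset.mem_image.1 he
  obtain ⟨e₂, -, h⟩ := Finset.mem_image.1 he'
  induction e₁ using Sym2.ind with
  | _ a b =>
    have h1 : blockVertex N m i a ∈ Sym2.map (blockVertex N m j) e₂ := by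
      rw [h, Sym2.map_mk]
      exact Sym2.mem_mk_left _ _
    obtain ⟨c, -, hc⟩ := Sym2.mem_map.1 h1
    exact hij (blockVertex_inj hj hi hc).1.symm

/-- The lengths of the blocks are independent and identically distributed, whence a bound for the
mean deviation of their sum. -/
theorem integral_abs_blockSum_sub_le (s β : ℝ) (hN : 2 * (m + 1) ≤ N) :
    ∫ ω, |(blockSum ω m (N / (m + 1)) : ℝ) - (N / (m + 1) : ℕ) * blockMean s β m| ∂law s β N ≤
      (m + 1) * √N := by
  set k := N / (m + 1) with hk
  set X : ℕ → Config N → ℝ := fun i ω => (blockLen (blockConfig ω m i) : ℝ) + 1 with hX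
  have hMem : ∀ i ∈ Finset.range k, MemLp (X i) 2 (law s β N) := fun i _ => .of_discrete
  have hmean : ∀ i ∈ Finset.range k, ∫ ω, X i ω ∂law s β N = blockMean s β m := fun i hi =>
    integral_blockConfig s β (succ_mul_le_of_lt_div (Finset.mem_range.1 hi)) hN
      fun η => (blockLen η : ℝ) + 1
  have hvar : variance (∑ i ∈ Finset.range k, X i) (law s β N) ≤ k * ((m : ℝ) + 1) ^ 2 := by
    rw [IndepFun.variance_sum hMem fun i hi j hj hij =>
      indepFun_blockConfig s β hij (succ_mul_le_of_lt_div (by simpa using hi))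
        (succ_mul_le_of_lt_div (by simpa using hj)) fun η => (blockLen η : ℝ) + 1]
    calc _ ≤ ∑ _i ∈ Finset.range k, ((m : ℝ) + 1) ^ 2 := by
          refine Finset.sum_le_sum fun i _ => ?_
          refine (variance_le_expectation_sq Measurable.of_discrete.aestronglyMeasurable).trans ?_
          calc _ ≤ ∫ _ω, ((m : ℝ) + 1) ^ 2 ∂law s β N := by
                refine integral_mono .of_finite .of_finite fun ω => ?_
                have : (blockLen (blockConfig ω m i) : ℝ) ≤ m := by
                  exact_mod_cast blockLen_le _
                simp only [hX, Pi.pow_apply]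
                gcongr
            _ = _ := by simp
      _ = _ := by simp
  have hsum : ∀ ω, (blockSum ω m k : ℝ) = (∑ i ∈ Finset.range k, X i) ω := fun ω => by
    simp [blockSum, hX]
  have hE : ∫ ω, (∑ i ∈ Finset.range k, X i) ω ∂law s β N = k * blockMean s β m := by
    simp only [Finset.sum_apply]
    rw [integral_finsetSum _ fun _ _ => .of_finite, Finset.sum_congr rfl hmean]
    simp
  set Y : Config N → ℝ := fun ω => (blockSum ω m k : ℝ) - k * blockMean s β m with hY
  have hYsq : ∫ ω, Y ω ^ 2 ∂law s β N ≤ k * ((m : ℝ) + 1) ^ 2 := by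
    rw [variance_eq_integral Measurable.of_discrete.aemeasurable, hE] at hvar
    refine le_trans (le_of_eq ?_) hvar
    refine integral_congr_ae (Eventually.of_forall fun ω => ?_)
    simp only [hY, hsum]
  have hJ : (∫ ω, |Y ω| ∂law s β N) ^ 2 ≤ ∫ ω, Y ω ^ 2 ∂law s β N := by
    have h1 := variance_nonneg (fun ω => |Y ω|) (law s β N)
    rw [variance_eq_sub .of_discrete] at h1
    simp only [Pi.pow_apply, sq_abs] at h1
    linarith
  have hkN : (k : ℝ) ≤ N := by exact_mod_cast Nat.div_le_self _ _
  refine abs_le_of_sq_le_sq' ?_ (by positivity) |>.2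
  rw [mul_pow, Real.sq_sqrt (Nat.cast_nonneg _)]
  nlinarith [sq_nonneg ((m : ℝ) + 1)]

end BlockLaw

/-! ### Pairs across blocks -/

/-- The vertex number `v` lies in one of the `N / (m + 1)` blocks and has at least `L` vertices of
this block on either side. -/
def Interior (N m L v : ℕ) : Prop :=
  v < N / (m + 1) * (m + 1) ∧ L ≤ v % (m + 1) ∧ v % (m + 1) + L < m + 1

theorem le_cycleDist_of_interior {N m L : ℕ} [NeZero N] {x y : ZMod N}
    (hx : Interior N m L x.val) (h : ¬ SameBlock m x y) : L ≤ cycleDist x y := by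
  by_contra! hlt
  refine h ?_
  obtain ⟨h1, h2, h3⟩ := hx
  have hxi : x.val / (m + 1) < N / (m + 1) := Nat.div_lt_of_lt_mul (by rwa [mul_comm])
  have hva := Nat.div_add_mod' x.val (m + 1)
  have hend := succ_mul_le_of_lt_div hxi
  rw [Nat.succ_mul] at hend
  have hd := cycleDist_eq_min x y
  have hy := y.val_lt
  have hY : x.val / (m + 1) * (m + 1) ≤ y.val ∧
      y.val < x.val / (m + 1) * (m + 1) + (m + 1) := by
    rw [Int.abs_eq_natAbs] at hd
    omega
  refine ⟨(Nat.div_eq_of_lt_le hY.1 (by rw [Nat.succ_mul]; exact hY.2)).symm, hxi⟩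

theorem card_not_interior_le {N m L : ℕ} [NeZero N] [DecidablePred (Interior N m L)] :
    (Finset.univ.filter fun x : ZMod N => ¬ Interior N m L x.val).card ≤
      N / (m + 1) * (2 * L) + (m + 1) := by
  classical
  set k := N / (m + 1) with hk
  let P : Finset ℕ := (Finset.range k ×ˢ (Finset.range L ∪ Finset.Ico (m + 1 - L) (m + 1))).image
    fun q => q.1 * (m + 1) + q.2
  have hsub : (Finset.univ.filter fun x : ZMod N => ¬ Interior N m L x.val) ⊆
      (P ∪ Finset.Ico (k * (m + 1)) N).image fun v : ℕ => (v : ZMod N) := by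
    intro x hx
    rw [Finset.mem_filter] at hx
    refine Finset.mem_image.2 ⟨x.val, ?_, ZMod.natCast_zmod_val x⟩
    by_cases hv : x.val < k * (m + 1)
    · refine Finset.mem_union_left _ (Finset.mem_image.2
        ⟨(x.val / (m + 1), x.val % (m + 1)), ?_, Nat.div_add_mod' _ _⟩)
      have h1 : x.val / (m + 1) < k := Nat.div_lt_of_lt_mul (by rwa [mul_comm])
      have h2 := Nat.mod_lt x.val (Nat.succ_pos m)
      have h3 := hx.2
      simp only [Interior, ← hk, hv, true_and, not_and] at h3
      simp only [Finset.mem_product, Finset.mem_range, h1, Finset.mem_union, Finset.mem_Ico,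
        true_and]
      simp only [Nat.succ_eq_add_one] at h2
      by_cases h4 : L ≤ x.val % (m + 1)
      · have := h3 h4
        omega
      · omega
    · refine Finset.mem_union_right _ (Finset.mem_Ico.2 ⟨not_lt.1 hv, x.val_lt⟩)
  have hP : P.card ≤ k * (2 * L) := by
    refine Finset.card_image_le.trans ?_
    rw [Finset.card_product, Finset.card_range]
    refine Nat.mul_le_mul_left k ((Finset.card_union_le _ _).trans ?_)
    rw [Finset.card_range, Nat.card_Ico]
    omega
  have hrest : (Finset.Ico (k * (m + 1)) N).card ≤ m + 1 := by
    rw [Nat.card_Ico]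
    have h1 := Nat.div_add_mod' N (m + 1)
    have h2 := Nat.mod_lt N (Nat.succ_pos m)
    rw [← hk] at h1
    simp only [Nat.succ_eq_add_one] at h2
    omega
  calc _ ≤ _ := Finset.card_le_card hsub
    _ ≤ _ := Finset.card_image_le
    _ ≤ _ := Finset.card_union_le _ _
    _ ≤ _ := Nat.add_le_add hP hrest

theorem summable_lengthWeight {s : ℝ} (hs : 2 < s) (β : ℝ) :
    Summable fun l : ℕ => β * (l : ℝ) ^ (1 - s) :=
  (Real.summable_nat_rpow.2 (by linarith)).mul_left β

/-- Few open pairs join different blocks: such a pair either has length at least `L` or has an end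
within `L` steps of the boundary of a block or in the incomplete block. -/
theorem integral_crossLen_le {s β : ℝ} (hs : 2 < s) (hβ : 0 ≤ β) {N m : ℕ} [NeZero N] (L : ℕ) :
    ∫ ω, (crossLen ω m : ℝ) ∂law s β N ≤
      N * (2 * ∑' l : ℕ, β * ((l + L : ℕ) : ℝ) ^ (1 - s)) +
        (N / (m + 1) * (2 * L) + (m + 1)) * (2 * ∑' l : ℕ, β * (l : ℝ) ^ (1 - s)) := by
  classical
  set w : ℕ → ℝ := fun l => β * (l : ℝ) ^ (1 - s) with hw
  have hwsum : Summable w := summable_lengthWeight hs β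
  have hw0 : ∀ l, 0 ≤ w l := fun l => by positivity
  have hW0 : 0 ≤ ∑' l, w l := tsum_nonneg hw0
  have hT0 : 0 ≤ ∑' l, w (l + L) := tsum_nonneg fun l => hw0 _
  have hpair : ∀ q : ZMod N × ZMod N,
      ∫ ω, (((if ω s(q.1, q.2) = true ∧ ¬ SameBlock m q.1 q.2 then cycleDist q.1 q.2 else 0 : ℕ))
        : ℝ) ∂law s β N ≤ if SameBlock m q.1 q.2 then 0 else w (cycleDist q.1 q.2) := by
    rintro ⟨x, y⟩
    by_cases hb : SameBlock m x y
    · simp [hb]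
    · simp only [hb, not_false_eq_true, and_true, if_false]
      have h1 : (fun ω : Config N => ((if ω s(x, y) = true then cycleDist x y else 0 : ℕ) : ℝ)) =
          fun ω => (cycleDist x y : ℝ) * (if ω s(x, y) = true then 1 else 0) := by
        funext ω
        split_ifs <;> simp
      rw [h1, integral_const_mul, law_eq_bitLaw, integral_indicator_open, pairProb_mk]
      rcases Nat.eq_zero_or_pos (cycleDist x y) with h0 | h0
      · rw [h0]
        simpa using hw0 0
      · have hpos : (0 : ℝ) < cycleDist x y := by exact_mod_cast h0
        calc _ ≤ (cycleDist x y : ℝ) * (β * (cycleDist x y : ℝ) ^ (-s)) := by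
              gcongr
              exact bondProb_le hβ _
          _ = _ := by
              simp only [hw]
              rw [show (1 - s) = 1 + (-s) by ring, Real.rpow_add hpos, Real.rpow_one]
              ring
  have hinner : ∀ x : ZMod N, ∑ y, (if SameBlock m x y then 0 else w (cycleDist x y)) ≤
      2 * ∑' l, w (l + L) + if Interior N m L x.val then 0 else 2 * ∑' l, w l := by
    intro x
    split_ifs with hx
    · set F : ℕ → ℝ := fun l => if L ≤ l then w l else 0 with hF
      have hF0 : ∀ l, 0 ≤ F l := fun l => by
        simp only [hF]
        split_ifs
        exacts [hw0 l, le_rfl]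
      calc _ ≤ ∑ y, F (cycleDist x y) := by
            refine Finset.sum_le_sum fun y _ => ?_
            split_ifs with hb
            · exact hF0 _
            · simp only [hF, if_pos (le_cycleDist_of_interior hx hb), le_refl]
        _ ≤ 2 * ∑ l ∈ Finset.range (N + 1), F l := sum_cycleDist_le hF0 x
        _ ≤ _ := by
            rw [add_zero]
            gcongr
            simp only [hF]
            rw [← Finset.sum_filter]
            have h1 : (Finset.range (N + 1)).filter (fun l => L ≤ l) =
                Finset.Ico L (N + 1) := by
              ext l
              simp only [Finset.mem_filter, Finset.mem_range, Finset.mem_Ico]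
              tauto
            rw [h1, Finset.sum_Ico_eq_sum_range]
            simp only [add_comm L]
            exact ((summable_nat_add_iff L).2 hwsum).sum_le_tsum _ fun l _ => hw0 _
    · calc _ ≤ ∑ y, w (cycleDist x y) := by
            refine Finset.sum_le_sum fun y _ => ?_
            split_ifs
            exacts [hw0 _, le_rfl]
        _ ≤ 2 * ∑ l ∈ Finset.range (N + 1), w l := sum_cycleDist_le hw0 x
        _ ≤ 2 * ∑' l, w l := by
            gcongr
            exact hwsum.sum_le_tsum _ fun l _ => hw0 _
        _ ≤ _ := by linarith
  calc _ = ∑ q : ZMod N × ZMod N, ∫ ω, (((if ω s(q.1, q.2) = true ∧ ¬ SameBlock m q.1 q.2 then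
        cycleDist q.1 q.2 else 0 : ℕ)) : ℝ) ∂law s β N := by
        rw [← integral_finsetSum _ fun _ _ => .of_finite]
        simp only [crossLen, Nat.cast_sum]
    _ ≤ _ := Finset.sum_le_sum fun q _ => hpair q
    _ = ∑ x : ZMod N, ∑ y, (if SameBlock m x y then 0 else w (cycleDist x y)) := by
        rw [Fintype.sum_prod_type]
    _ ≤ _ := Finset.sum_le_sum fun x _ => hinner x
    _ = N * (2 * ∑' l, w (l + L)) +
        ((Finset.univ.filter fun x : ZMod N => ¬ Interior N m L x.val).card : ℝ) *
          (2 * ∑' l, w l) := by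
        rw [Finset.sum_add_distrib, Finset.sum_const, Finset.card_univ, ZMod.card, nsmul_eq_mul]
        congr 1
        simp_rw [← ite_not (p := Interior N m L _)]
        rw [← Finset.sum_filter, Finset.sum_const, nsmul_eq_mul]
    _ ≤ _ := by
        gcongr
        have h1 := card_not_interior_le (N := N) (m := m) (L := L)
        have h2 : ((Finset.univ.filter fun x : ZMod N => ¬ Interior N m L x.val).card : ℝ) ≤
            (N / (m + 1) : ℕ) * (2 * L) + (m + 1) := by exact_mod_cast h1
        have h3 : ((N / (m + 1) : ℕ) : ℝ) ≤ (N : ℝ) / (m + 1) := by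
          have := Nat.cast_div_le (α := ℝ) (m := N) (n := m + 1)
          push_cast at this
          exact this
        refine h2.trans ?_
        gcongr

/-- The ratio `D(N) / N` is close in mean to the ratio of the mean contribution of a block to twice
its length. -/
theorem integral_abs_diameter_sub_le {s β : ℝ} (hs : 2 < s) (hβ : 0 ≤ β) {N m : ℕ} [NeZero N]
    (hN : 2 * (m + 1) ≤ N) (L : ℕ) :
    ∫ ω, |(diameter ω : ℝ) / N - blockMean s β m / (2 * (m + 1))| ∂law s β N ≤
      ((m + 1) * (4 + 2 * ∑' l : ℕ, β * (l : ℝ) ^ (1 - s))) / N + (m + 1) / √N +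
        2 * ∑' l : ℕ, β * ((l + L : ℕ) : ℝ) ^ (1 - s) +
          4 * L * (∑' l : ℕ, β * (l : ℝ) ^ (1 - s)) / (m + 1) := by
  set τ := blockMean s β m with hτ
  set W := ∑' l : ℕ, β * (l : ℝ) ^ (1 - s) with hW
  set T := ∑' l : ℕ, β * ((l + L : ℕ) : ℝ) ^ (1 - s) with hT
  have hN0 : (0 : ℝ) < N := by exact_mod_cast NeZero.pos N
  have hm0 : (0 : ℝ) < m + 1 := by positivity
  have hkN : |((N / (m + 1) : ℕ) : ℝ) * τ - N * (τ / (m + 1))| ≤ m + 1 := by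
    have h1 := Nat.div_add_mod' N (m + 1)
    have h2 : ((N / (m + 1) : ℕ) : ℝ) * (m + 1) + (N % (m + 1) : ℕ) = N := by exact_mod_cast h1
    have h3 : ((N % (m + 1) : ℕ) : ℝ) ≤ m + 1 := by
      exact_mod_cast (Nat.mod_lt N (Nat.succ_pos m)).le
    have h4 : ((N / (m + 1) : ℕ) : ℝ) * τ - N * (τ / (m + 1)) =
        -((N % (m + 1) : ℕ) * (τ / (m + 1))) := by
      rw [← h2]
      field_simp
      ring
    have h5 : 0 ≤ τ := blockMean_nonneg s β m
    have h6 : τ / (m + 1) ≤ 1 := by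
      rw [div_le_one hm0]
      exact blockMean_le s β m
    rw [h4, abs_neg, abs_of_nonneg (by positivity)]
    calc _ ≤ ((m : ℝ) + 1) * 1 := by gcongr
      _ = _ := mul_one _
  have hpt : ∀ ω : Config N, |(diameter ω : ℝ) / N - τ / (2 * (m + 1))| ≤
      (|(blockSum ω m (N / (m + 1)) : ℝ) - (N / (m + 1) : ℕ) * τ| + 2 * crossLen ω m +
        7 * (m + 1)) / (2 * N) := by
    intro ω
    have h1 : (circuitLen ω m : ℝ) ≤ 2 * diameter ω + 2 * crossLen ω m + 1 := by
      exact_mod_cast circuitLen_le ω (m := m)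
    have h2 : (2 * diameter ω : ℝ) ≤ circuitLen ω m + 4 * (m + 1) := by
      exact_mod_cast two_mul_diameter_le ω (m := m)
    have h3 : (circuitLen ω m : ℝ) = blockSum ω m (N / (m + 1)) + (N % (m + 1) : ℕ) := by
      simp [circuitLen]
    have h4 : ((N % (m + 1) : ℕ) : ℝ) ≤ m + 1 := by
      exact_mod_cast (Nat.mod_lt N (Nat.succ_pos m)).le
    have h5 : (0 : ℝ) ≤ (N % (m + 1) : ℕ) := Nat.cast_nonneg _
    have h6 : (0 : ℝ) ≤ crossLen ω m := Nat.cast_nonneg _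
    have h7 : (0 : ℝ) ≤ m := Nat.cast_nonneg _
    have h8 : (diameter ω : ℝ) / N - τ / (2 * (m + 1)) =
        (2 * diameter ω - N * (τ / (m + 1))) / (2 * N) := by
      field_simp
    rw [h8, abs_div, abs_of_pos (show (0 : ℝ) < 2 * N by positivity)]
    gcongr
    have h9 := abs_le.1 hkN
    have h10 := neg_abs_le ((blockSum ω m (N / (m + 1)) : ℝ) - (N / (m + 1) : ℕ) * τ)
    have h11 := le_abs_self ((blockSum ω m (N / (m + 1)) : ℝ) - (N / (m + 1) : ℕ) * τ)
    rw [abs_le]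
    constructor <;> linarith [h9.1, h9.2]
  have hB := integral_abs_blockSum_sub_le (N := N) (m := m) s β hN
  have hC := integral_crossLen_le hs hβ (N := N) (m := m) L
  rw [← hτ] at hB
  calc _ ≤ ∫ ω, (|(blockSum ω m (N / (m + 1)) : ℝ) - (N / (m + 1) : ℕ) * τ| +
        2 * crossLen ω m + 7 * (m + 1)) / (2 * N) ∂law s β N :=
        integral_mono .of_finite .of_finite hpt
    _ = ((∫ ω, |(blockSum ω m (N / (m + 1)) : ℝ) - (N / (m + 1) : ℕ) * τ| ∂law s β N) +
        2 * (∫ ω, (crossLen ω m : ℝ) ∂law s β N) + 7 * (m + 1)) / (2 * N) := by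
        rw [integral_div, integral_add .of_finite .of_finite,
          integral_add .of_finite .of_finite, integral_const_mul]
        simp
    _ ≤ ((m + 1) * √N + 2 * (N * (2 * T) + (N / (m + 1) * (2 * L) + (m + 1)) * (2 * W)) +
        7 * (m + 1)) / (2 * N) := by
        gcongr
    _ = ((m + 1) * (7 / 2 + 2 * W)) / N + (m + 1) / √N / 2 + 2 * T + 4 * L * W / (m + 1) := by
        have h1 : ((m : ℝ) + 1) / √N / 2 = (m + 1) * √N / (2 * N) := by
          rw [div_eq_mul_one_div ((m : ℝ) + 1), ← Real.sqrt_div_self']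
          field_simp
        rw [h1]
        field_simp
        ring
    _ ≤ _ := by
        have h1 : 0 ≤ ((m : ℝ) + 1) / √N := by positivity
        have h2 : ((m : ℝ) + 1) * (7 / 2 + 2 * W) / N ≤ (m + 1) * (4 + 2 * W) / N := by
          gcongr
          norm_num
        linarith

/-! ### Cut points -/

/-- No open pair of the block crosses from the vertices up to `a` to the vertices after `a`. -/
def CutAt {m : ℕ} (η : Sym2 (Fin (m + 1)) → Bool) (a : ℕ) : Prop :=
  ∀ u v : Fin (m + 1), (u : ℕ) ≤ a → a < v → η s(u, v) = false

open Classical in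
/-- Each cut has to be crossed by a step of its own, because the number of cuts below a vertex
changes by at most `1` along an edge. -/
theorem sum_cutAt_le_blockLen {m : ℕ} (η : Sym2 (Fin (m + 1)) → Bool) :
    ∑ a ∈ Finset.range m, (if CutAt η a then 1 else 0) ≤ blockLen η := by
  let G : Fin (m + 1) → ℤ := fun u =>
    ((∑ a ∈ Finset.range (u : ℕ), (if CutAt η a then 1 else 0) : ℕ) : ℤ)
  have hlt : ∀ u v : Fin (m + 1), (u : ℕ) < v → (blockGraph η).Adj u v → |G u - G v| ≤ 1 := by
    intro u v huv hadj
    by_cases hsucc : (u : ℕ) + 1 = v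
    · simp only [G, ← hsucc, Finset.sum_range_succ]
      split_ifs <;> push_cast <;> simp
    · have ho : η s(u, v) = true := by
        rcases hadj.2 with h | h | h
        · exact absurd h hsucc
        · omega
        · exact h
      have hG : G u = G v := by
        simp only [G]
        congr 1
        refine Finset.sum_subset (Finset.range_subset_range.2 huv.le) fun a ha hau => ?_
        rw [Finset.mem_range] at ha hau
        refine if_neg fun hc => ?_
        have := hc u v (by omega) ha
        rw [ho] at this
        exact absurd this (by simp)
      simp [hG]
  have hG : ∀ u v, (blockGraph η).Adj u v →
      |G u - G v| ≤ 1 + ((fun _ _ => 0 : Fin (m + 1) → Fin (m + 1) → ℕ) u v : ℤ) := by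
    intro u v hadj
    simp only [Nat.cast_zero, add_zero]
    rcases lt_trichotomy (u : ℕ) v with h | h | h
    · exact hlt u v h hadj
    · exact absurd (Fin.ext h) hadj.ne
    · rw [abs_sub_comm]
      exact hlt v u h hadj.symm
  obtain ⟨p, hp, hl⟩ := (blockGraph_connected η).exists_path_of_dist 0 (Fin.last m)
  have h := abs_sub_le_length_add_sum hG p hp
  have h0 : G 0 = 0 := by simp [G]
  have hlast : G (Fin.last m) =
      ((∑ a ∈ Finset.range m, (if CutAt η a then 1 else 0) : ℕ) : ℤ) := rfl
  rw [hl, h0, hlast, zero_sub, abs_neg] at h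
  simp only [Nat.cast_zero, Finset.sum_const_zero, add_zero] at h
  have h1 := (le_abs_self _).trans h
  rw [blockLen]
  exact_mod_cast h1

/-- A lower bound, uniform in the block and in the position, for the probability of a cut. The sum
of the `|u - v|^{-s}` over the crossing pairs is bounded by a product of two convergent series. -/
theorem prob_cutAt_ge {s β : ℝ} (hs : 2 < s) (hβ : 0 ≤ β) {m a : ℕ} :
    Real.exp (-(β * (∑' l : ℕ, ((l + 1 : ℕ) : ℝ) ^ (-(s / 2))) ^ 2)) ≤
      (bitLaw (blockProb s β m)).real {η | CutAt η a} := by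
  classical
  set z : ℕ → ℝ := fun l => ((l + 1 : ℕ) : ℝ) ^ (-(s / 2)) with hz
  have hzsum : Summable z :=
    (summable_nat_add_iff 1).2 (Real.summable_nat_rpow.2 (by linarith : -(s / 2) < -1))
  have hz0 : ∀ l, 0 ≤ z l := fun l => by positivity
  let U : Finset (Fin (m + 1)) := Finset.univ.filter fun u => (u : ℕ) ≤ a
  let V : Finset (Fin (m + 1)) := Finset.univ.filter fun v => a < (v : ℕ)
  have hinj : Set.InjOn (fun q : Fin (m + 1) × Fin (m + 1) => s(q.1, q.2)) (U ×ˢ V : Finset _) := by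
    rintro ⟨u, v⟩ h ⟨u', v'⟩ h' heq
    simp only [Finset.coe_product, Set.mem_prod, Finset.mem_coe, U, V, Finset.mem_filter,
      Finset.mem_univ, true_and] at h h'
    simp only [Sym2.eq_iff] at heq
    rcases heq with ⟨rfl, rfl⟩ | ⟨rfl, rfl⟩
    · rfl
    · omega
  have hset : {η : Sym2 (Fin (m + 1)) → Bool | CutAt η a} =
      {η | ∀ e ∈ (U ×ˢ V).image (fun q => s(q.1, q.2)), η e = false} := by
    ext η
    simp only [Set.mem_ofPred_eq, Finset.mem_image, Finset.mem_product, Prod.exists, U, V,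
      Finset.mem_filter, Finset.mem_univ, true_and, CutAt]
    constructor
    · rintro h e ⟨u, v, ⟨hu, hv⟩, rfl⟩
      exact h u v hu hv
    · exact fun h u v hu hv => h _ ⟨u, v, ⟨hu, hv⟩, rfl⟩
  have hterm : ∀ q ∈ U ×ˢ V, Real.exp (-(β * (z (a - q.1) * z (q.2 - a - 1)))) ≤
      1 - (blockProb s β m s(q.1, q.2) : ℝ) := by
    rintro ⟨u, v⟩ hq
    simp only [Finset.mem_product, U, V, Finset.mem_filter, Finset.mem_univ, true_and] at hq
    obtain ⟨hu, hv⟩ := hq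
    rw [blockProb_mk, one_sub_bondProb hβ, Real.exp_le_exp, neg_mul, neg_le_neg_iff]
    refine mul_le_mul_of_nonneg_left ?_ hβ
    obtain ⟨i, hi⟩ := Nat.exists_eq_add_of_le hu
    obtain ⟨j, hj⟩ := Nat.exists_eq_add_of_lt hv
    have h1 : (((u : ℕ) : ℤ) - (v : ℕ)).natAbs = i + j + 1 := by omega
    have h2 : a - (u : ℕ) = i := by omega
    have h3 : (v : ℕ) - a - 1 = j := by omega
    simp only [h1, h2, h3, hz]
    rw [← Real.mul_rpow (by positivity) (by positivity),
      show -s = 2 * (-(s / 2)) by ring, Real.rpow_mul (by positivity), Real.rpow_two]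
    -- The factorization rests on `(i + 1) * (j + 1) ≤ (i + j + 1) ^ 2`.
    refine Real.rpow_le_rpow_of_nonpos (by positivity) ?_ (by linarith)
    push_cast
    nlinarith [Nat.cast_nonneg (α := ℝ) i, Nat.cast_nonneg (α := ℝ) j,
      mul_nonneg (Nat.cast_nonneg (α := ℝ) i) (Nat.cast_nonneg (α := ℝ) j)]
  have hU : ∑ u ∈ U, z (a - u) ≤ ∑' l, z l := by
    have h1 : ∑ l ∈ U.image (fun u : Fin (m + 1) => a - (u : ℕ)), z l = ∑ u ∈ U, z (a - u) := by
      refine Finset.sum_image fun u hu u' hu' h => ?_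
      simp only [U, Finset.coe_filter, Finset.mem_univ, true_and, Set.mem_ofPred_eq] at hu hu'
      exact Fin.ext (by omega)
    rw [← h1]
    exact hzsum.sum_le_tsum _ fun l _ => hz0 l
  have hV : ∑ v ∈ V, z (v - a - 1) ≤ ∑' l, z l := by
    have h1 : ∑ l ∈ V.image (fun v : Fin (m + 1) => (v : ℕ) - a - 1), z l =
        ∑ v ∈ V, z (v - a - 1) := by
      refine Finset.sum_image fun u hu u' hu' h => ?_
      simp only [V, Finset.coe_filter, Finset.mem_univ, true_and, Set.mem_ofPred_eq] at hu hu'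
      exact Fin.ext (by omega)
    rw [← h1]
    exact hzsum.sum_le_tsum _ fun l _ => hz0 l
  rw [hset, bitLaw_forall_closed, Finset.prod_image hinj]
  calc _ ≤ Real.exp (∑ q ∈ U ×ˢ V, -(β * (z (a - q.1) * z (q.2 - a - 1)))) := by
        rw [Real.exp_le_exp, Finset.sum_neg_distrib, neg_le_neg_iff, ← Finset.mul_sum,
          Finset.sum_product]
        refine mul_le_mul_of_nonneg_left ?_ hβ
        refine (Finset.sum_mul_sum U V (fun u => z (a - u)) fun v => z (v - a - 1)).symm.trans_le ?_
        rw [sq]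
        exact mul_le_mul hU hV (Finset.sum_nonneg fun _ _ => hz0 _) (tsum_nonneg hz0)
    _ = ∏ q ∈ U ×ˢ V, Real.exp (-(β * (z (a - q.1) * z (q.2 - a - 1)))) := Real.exp_sum _ _
    _ ≤ _ := Finset.prod_le_prod (fun _ _ => (Real.exp_pos _).le) hterm

/-- Blocks have a positive speed: the mean contribution of a block is at least a fixed proportion of
its length. -/
theorem exists_le_blockMean {s β : ℝ} (hs : 2 < s) (hβ : 0 ≤ β) :
    ∃ q : ℝ, 0 < q ∧ ∀ m : ℕ, q * (m + 1) ≤ blockMean s β m := by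
  classical
  set q := Real.exp (-(β * (∑' l : ℕ, ((l + 1 : ℕ) : ℝ) ^ (-(s / 2))) ^ 2)) with hq
  have hq1 : q ≤ 1 := by
    rw [hq, Real.exp_le_one_iff, neg_nonpos]
    positivity
  refine ⟨q, Real.exp_pos _, fun m => ?_⟩
  calc q * (m + 1) ≤ ∑ a ∈ Finset.range m, q + 1 := by
        rw [Finset.sum_const, Finset.card_range, nsmul_eq_mul]
        linarith
    _ ≤ ∑ a ∈ Finset.range m, (bitLaw (blockProb s β m)).real {η | CutAt η a} + 1 := by
        gcongr with a
        exact prob_cutAt_ge hs hβ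
    _ = ∫ η, (∑ a ∈ Finset.range m, (if CutAt η a then (1 : ℝ) else 0) + 1)
          ∂bitLaw (blockProb s β m) := by
        rw [integral_add .of_finite .of_finite, integral_finsetSum _ fun _ _ => .of_finite]
        simp only [integral_const, probReal_univ, one_smul]
        congr 1
        refine Finset.sum_congr rfl fun a _ => ?_
        rw [← integral_indicator_one (Set.toFinite _).measurableSet]
        refine integral_congr_ae (Eventually.of_forall fun η => ?_)
        simp [Set.indicator_apply]
    _ ≤ _ := by
        refine integral_mono .of_finite .of_finite fun η => ?_
        have h := sum_cutAt_le_blockLen η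
        have h' : (∑ a ∈ Finset.range m, (if CutAt η a then (1 : ℝ) else 0)) ≤ blockLen η := by
          exact_mod_cast h
        simpa using h'

/-! ### Linear diameter when `s > 2` -/

/-- The mean of `D(N) / N` is a Cauchy sequence since it is close to the speed of long blocks. -/
theorem exists_tendsto_integral_abs_sub {s β : ℝ} (hs : 2 < s) (hβ : 0 ≤ β) :
    ∃ η : ℝ, 0 < η ∧ η ≤ 1 ∧ Tendsto
      (fun N : ℕ+ => ∫ ω, |(diameter ω : ℝ) / (N : ℝ) - η| ∂law s β N) atTop (𝓝 0) := by
  set W := ∑' l : ℕ, β * (l : ℝ) ^ (1 - s) with hW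
  have hc : Tendsto (fun N : ℕ+ => ((N : ℕ) : ℝ)) atTop atTop :=
    tendsto_natCast_atTop_atTop.comp tendsto_PNat_val_atTop_atTop
  obtain ⟨q, hq0, hq⟩ := exists_le_blockMean hs hβ
  -- Approximation of `D(N) / N` by the speed of suitable blocks.
  have happrox : ∀ ε > 0, ∃ a : ℝ, q / 2 ≤ a ∧ ∀ᶠ N : ℕ+ in atTop,
      ∫ ω, |(diameter ω : ℝ) / (N : ℝ) - a| ∂law s β N < ε := by
    intro ε hε
    have hT := tendsto_sum_nat_add fun l : ℕ => β * (l : ℝ) ^ (1 - s)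
    obtain ⟨L, hL⟩ := (hT.eventually (gt_mem_nhds (show 0 < ε / 8 by positivity))).exists
    have hm : Tendsto (fun m : ℕ => 4 * L * W / ((m : ℝ) + 1)) atTop (𝓝 0) :=
      tendsto_const_nhds.div_atTop
        (tendsto_atTop_add_const_right _ _ tendsto_natCast_atTop_atTop)
    obtain ⟨m, hm⟩ := (hm.eventually (gt_mem_nhds (show 0 < ε / 4 by positivity))).exists
    refine ⟨blockMean s β m / (2 * (m + 1)), ?_, ?_⟩
    · rw [div_le_div_iff₀ (by norm_num) (by positivity)]
      linarith [hq m]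
    have h1 : Tendsto (fun N : ℕ+ => ((m + 1) * (4 + 2 * W)) / ((N : ℕ) : ℝ)) atTop (𝓝 0) :=
      tendsto_const_nhds.div_atTop hc
    have h2 : Tendsto (fun N : ℕ+ => ((m : ℝ) + 1) / √((N : ℕ) : ℝ)) atTop (𝓝 0) :=
      tendsto_const_nhds.div_atTop (Real.tendsto_sqrt_atTop.comp hc)
    filter_upwards [h1.eventually (gt_mem_nhds (show 0 < ε / 4 by positivity)),
      h2.eventually (gt_mem_nhds (show 0 < ε / 4 by positivity)),
      tendsto_PNat_val_atTop_atTop.eventually (eventually_ge_atTop (2 * (m + 1)))]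
      with N h3 h4 h5
    have h6 := integral_abs_diameter_sub_le hs hβ (N := N) h5 L
    rw [← hW] at h6
    linarith
  set e : ℕ+ → ℝ := fun N => ∫ ω, (diameter ω : ℝ) / (N : ℝ) ∂law s β N with he
  have hdiff : ∀ (N : ℕ+) (a : ℝ),
      |e N - a| ≤ ∫ ω, |(diameter ω : ℝ) / (N : ℝ) - a| ∂law s β N := by
    intro N a
    have h1 : e N - a = ∫ ω, ((diameter ω : ℝ) / (N : ℝ) - a) ∂law s β N := by
      rw [integral_sub .of_finite .of_finite]
      simp [he]
    rw [h1]
    exact abs_integral_le_integral_abs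
  have hcauchy : CauchySeq e := by
    rw [Metric.cauchySeq_iff]
    intro ε hε
    obtain ⟨a, -, ha⟩ := happrox (ε / 2) (by positivity)
    obtain ⟨N₀, hN₀⟩ := eventually_atTop.1 ha
    refine ⟨N₀, fun M hM N hN => ?_⟩
    have h1 := (hdiff M a).trans_lt (hN₀ M hM)
    have h2 := (hdiff N a).trans_lt (hN₀ N hN)
    rw [Real.dist_eq]
    rw [abs_lt] at *
    constructor <;> linarith [h1.1, h1.2, h2.1, h2.2]
  obtain ⟨η, hη⟩ := cauchySeq_tendsto_of_complete hcauchy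
  have hnear : ∀ ε > 0, ∃ a : ℝ, q / 2 ≤ a ∧ |a - η| ≤ ε ∧ ∀ᶠ N : ℕ+ in atTop,
      ∫ ω, |(diameter ω : ℝ) / (N : ℝ) - a| ∂law s β N < ε := by
    intro ε hε
    obtain ⟨a, hqa, ha⟩ := happrox ε hε
    refine ⟨a, hqa, ?_, ha⟩
    rw [abs_sub_comm]
    exact le_of_tendsto (hη.sub_const a).abs (ha.mono fun N hN => (hdiff N a).trans hN.le)
  refine ⟨η, ?_, ?_, ?_⟩
  · obtain ⟨a, hqa, ha, -⟩ := hnear (q / 4) (by positivity)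
    have := (abs_le.1 ha).2
    linarith
  · refine le_of_tendsto hη (Eventually.of_forall fun N => ?_)
    calc e N ≤ ∫ _ω, (1 : ℝ) ∂law s β N := by
          refine integral_mono .of_finite .of_finite fun ω => ?_
          have h1 : (diameter ω : ℝ) ≤ ((N : ℕ) : ℝ) := by exact_mod_cast diameter_le_card ω
          exact div_le_one_of_le₀ h1 (Nat.cast_nonneg _)
      _ = 1 := by simp
  · rw [Metric.tendsto_nhds]
    intro ε hε
    obtain ⟨a, -, ha, hev⟩ := hnear (ε / 2) (by positivity)
    filter_upwards [hev] with N hN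
    have h1 : ∫ ω, |(diameter ω : ℝ) / (N : ℝ) - η| ∂law s β N ≤
        ∫ ω, (|(diameter ω : ℝ) / (N : ℝ) - a| + |a - η|) ∂law s β N :=
      integral_mono .of_finite .of_finite fun ω => abs_sub_le _ a _
    rw [integral_add .of_finite .of_finite] at h1
    simp only [integral_const, probReal_univ, one_smul] at h1
    rw [Real.dist_eq, sub_zero, abs_of_nonneg (integral_nonneg fun _ => abs_nonneg _)]
    linarith

/-- Convergence in mean implies convergence in distribution. -/
theorem tendstoInDistribution_of_tendsto_integral_abs_sub {s β η : ℝ}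
    (h : Tendsto (fun N : ℕ+ => ∫ ω, |(diameter ω : ℝ) / (N : ℝ) - η| ∂law s β N) atTop (𝓝 0)) :
    TendstoInDistribution (fun (N : ℕ+) (ω : Config N) => (diameter ω : ℝ) / (N : ℝ))
      atTop (fun _ : Unit => η) (fun N : ℕ+ => law s β N) (Measure.dirac ()) where
  forall_aemeasurable N := Measurable.of_discrete.aemeasurable
  aemeasurable_limit := measurable_const.aemeasurable
  tendsto := by
    refine tendsto_iff_forall_lipschitz_integral_tendsto.2 ?_
    rintro f - ⟨K, hf⟩
    simp only [ProbabilityMeasure.coe_mk]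
    have h1 : ∀ N : ℕ+, ∫ x, f x ∂(law s β N).map (fun ω => (diameter ω : ℝ) / (N : ℝ)) =
        ∫ ω, f ((diameter ω : ℝ) / (N : ℝ)) ∂law s β N := fun N =>
      integral_map Measurable.of_discrete.aemeasurable
        hf.continuous.measurable.aestronglyMeasurable
    have h2 : ∫ x, f x ∂(Measure.dirac ()).map (fun _ : Unit => η) = f η := by
      rw [integral_map measurable_const.aemeasurable
        hf.continuous.measurable.aestronglyMeasurable]
      simp
    simp only [h1, h2]
    rw [tendsto_iff_norm_sub_tendsto_zero]
    refine squeeze_zero (fun _ => norm_nonneg _) (fun N => ?_)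
      (by simpa using h.const_mul (K : ℝ))
    have h3 : (∫ ω, f ((diameter ω : ℝ) / (N : ℝ)) ∂law s β N) - f η =
        ∫ ω, (f ((diameter ω : ℝ) / (N : ℝ)) - f η) ∂law s β N := by
      rw [integral_sub .of_finite .of_finite]
      simp
    rw [h3, ← integral_const_mul]
    refine (norm_integral_le_integral_norm _).trans ?_
    refine integral_mono .of_finite .of_finite fun ω => ?_
    have := hf.dist_le_mul ((diameter ω : ℝ) / (N : ℝ)) η
    rwa [Real.dist_eq, Real.dist_eq] at this

theorem tendsto_prob_diameter_lt_mul {s β η : ℝ} (hη : 0 < η)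
    (h : Tendsto (fun N : ℕ+ => ∫ ω, |(diameter ω : ℝ) / (N : ℝ) - η| ∂law s β N) atTop (𝓝 0)) :
    Tendsto (fun N : ℕ+ => law s β N {ω | (diameter ω : ℝ) < η / 2 * (N : ℝ)}) atTop (𝓝 0) := by
  have h1 : Tendsto (fun N : ℕ+ =>
      (law s β N).real {ω | (diameter ω : ℝ) < η / 2 * (N : ℝ)}) atTop (𝓝 0) := by
    refine squeeze_zero (fun _ => measureReal_nonneg) (fun N => ?_)
      (by simpa using h.const_mul (2 / η))
    have hN : (0 : ℝ) < ((N : ℕ) : ℝ) := Nat.cast_pos.2 N.pos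
    have h2 : η / 2 * (law s β N).real {ω | (diameter ω : ℝ) < η / 2 * (N : ℝ)} ≤
        ∫ ω, |(diameter ω : ℝ) / (N : ℝ) - η| ∂law s β N := by
      refine le_trans (mul_le_mul_of_nonneg_left (measureReal_mono (fun ω hω => ?_)
        (measure_ne_top _ _)) (by positivity)) (mul_meas_ge_le_integral_of_nonneg
          (Eventually.of_forall fun _ => abs_nonneg _) .of_finite (η / 2))
      rw [Set.mem_ofPred_eq, ← div_lt_iff₀ hN] at hω
      rw [Set.mem_ofPred_eq, abs_sub_comm]
      exact le_trans (by linarith) (le_abs_self _)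
    calc _ = 2 / η * (η / 2 * (law s β N).real {ω | (diameter ω : ℝ) < η / 2 * (N : ℝ)}) := by
          rw [← mul_assoc, show 2 / η * (η / 2) = 1 by field_simp, one_mul]
      _ ≤ _ := by gcongr
  have h2 := (ENNReal.continuous_ofReal.tendsto 0).comp h1
  simpa [Function.comp_def, ofReal_measureReal] using h2

end LongRange

theorem theorem1 (s β : ℝ) (hs : 0 < s) (hβ : 0 < β) :
    (2 < s →
      (∃ C : ℝ, 0 < C ∧
        Tendsto (fun N : ℕ+ => LongRange.law s β N
          {ω | (LongRange.diameter ω : ℝ) < C * (N : ℝ)}) atTop (𝓝 0)) ∧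
      (∃ η : ℝ, 0 < η ∧ η ≤ 1 ∧
        TendstoInDistribution
          (fun (N : ℕ+) (ω : LongRange.Config N) => (LongRange.diameter ω : ℝ) / (N : ℝ))
          atTop (fun _ : Unit => η) (fun N : ℕ+ => LongRange.law s β N) (Measure.dirac ()))) ∧
    (s < 1 →
      ∃ C : ℝ, Tendsto (fun N : ℕ+ => LongRange.law s β N
        {ω | C < (LongRange.diameter ω : ℝ)}) atTop (𝓝 0)) ∧
    (1 < s → s < 2 →
      ∃ δ : ℝ, Tendsto (fun N : ℕ+ => LongRange.law s β N
        {ω | Real.log (N : ℝ) ^ δ < (LongRange.diameter ω : ℝ)}) atTop (𝓝 0)) ∧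
    (1 < s → s < 2 →
      ∃ C : ℝ, 0 < C ∧ Tendsto (fun N : ℕ+ => LongRange.law s β N
        {ω | (LongRange.diameter ω : ℝ) < C * Real.log (N : ℝ)}) atTop (𝓝 0)) := by
  refine ⟨fun h2 => ?_, fun h1 => LongRange.tendsto_prob_diameter_gt_const hs h1 hβ,
    fun _ h2 => LongRange.tendsto_prob_diameter_gt_log_rpow hs h2 hβ,
    fun h1 _ => LongRange.tendsto_prob_diameter_lt_log h1 hβ⟩
  obtain ⟨η, hη0, hη1, hη⟩ := LongRange.exists_tendsto_integral_abs_sub h2 hβ.le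
  exact ⟨⟨η / 2, half_pos hη0, LongRange.tendsto_prob_diameter_lt_mul hη0 hη⟩,
    η, hη0, hη1, LongRange.tendstoInDistribution_of_tendsto_integral_abs_sub hη⟩
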